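/- For a finite alphabet $\Sigma$, a quantitative language is a function $L:\Sigma^\omega\to\mathbb{R}$. The value of a bounded real sequence $v=v_0v_1\dots$ is either $\mathsf{LimInfAvg}(v)=\liminf_{n\to\infty}\frac1n\sum_{i<n}v_i$ or $\mathsf{LimSupAvg}(v)=\limsup_{n\to\infty}\frac1n\sum_{i<n}v_i$. A nondeterministic mean-payoff automaton has a finite set of states, an initial state, a total transition relation (for all $q,\sigma$ there is at least one transition $(q,\sigma,q')$) and rational weights on transitions, together with a choice $\mathsf{Val}\in\{\mathsf{LimInfAvg},\mathsf{LimSupAvg}\}$; it assigns to a word $w$ the supremum of $\mathsf{Val}$ of the weight sequences of its runs over $w$. It is deterministic if for all $q,\sigma$ there is exactly one transition $(q,\sigma,q')$. An alternating mean-payoff automaton has instead, for each state and letter, a positive Boolean formula (without constants) over the states, and rational weights on triples $(q,\sigma,q')$: on a word $w$, when letter $\sigma$ is read in state $q$, player 1 chooses a set of states satisfying the formula of $(q,\sigma)$, and player 2 chooses the next state from that set; the value of $w$ is $\sup_s\inf_r\mathsf{Val}(r)$, where $s$ ranges over the (history-dependent) strategies of player 1 over $w$, $r$ over the outcomes consistent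 with $s$, and $\mathsf{Val}(r)$ is $\mathsf{Val}$ of the weight sequence of $r$. Mean-payoff automaton expressions are given by $E::=A\mid\max(E,E)\mid\min(E,E)\mid\mathrm{sum}(E,E)$, with $A$ a deterministic $\mathsf{LimInfAvg}$- or $\mathsf{LimSupAvg}$-automaton, interpreted pointwise. Theorem. Mean-payoff automaton expressions are incomparable in expressive power with nondeterministic and with alternating mean-payoff automata: (a) There are a finite alphabet $\Sigma$ and deterministic mean-payoff automata $A_1,A_2$ over $\Sigma$ (each either $\mathsf{LimInfAvg}$ or $\mathsf{LimSupAvg}$) such that the language of the expression $\mathrm{sum}(A_1,A_2)$ is not the language of any alternating mean-payoff automaton, nor of any nondeterministic mean-payoff automaton, with either value function. (b) Over $\Sigma=\{a,b\}$, let $L_F(w)=1$ if $w$ contains finitely many $a$'s, and $L_F(w)=0$ otherwise. For each of the two value functions, $L_F$ is the language of a nondeterministic mean-payoff automaton and the language of an alternating mean-payoff automaton, but $L_F$ is not the language of any mean-payoff automaton expression. -/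

import Mathlib

open Filter

namespace MeanPayoff

/-- A quantitative language over the alphabet `α`: a real number for each infinite word. -/
abbrev QuantLang (α : Type) : Type := (ℕ → α) → ℝ

/-- The two limit-average value functions. -/
inductive Mode where
  | limInfAvg
  | limSupAvg

/-- The mean of the first `n` elements of a sequence. -/
noncomputable def avg (v : ℕ → ℝ) (n : ℕ) : ℝ :=
  (1 / (n : ℝ)) * ∑ i ∈ Finset.range n, v i

/-- The mean-payoff value of a sequence. It is applied only to bounded sequences. -/
noncomputable def Mode.val (m : Mode) (v : ℕ → ℝ) : ℝ :=
  match m with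
  | .limInfAvg => liminf (avg v) atTop
  | .limSupAvg => limsup (avg v) atTop

/-- A (nondeterministic) weighted automaton over `α`: finitely many states, a total transition
relation, and rational weights. Only the weights of triples in `trans` matter. -/
structure WeightedAutomaton (α : Type) where
  State : Type
  finite : Finite State
  init : State
  trans : State → α → State → Prop
  total : ∀ q a, ∃ q', trans q a q'
  wt : State → α → State → ℚ

namespace WeightedAutomaton

variable {α : Type}

/-- Each state has exactly one successor for each letter. -/
def IsDeterministic (A : WeightedAutomaton α) : Prop :=
  ∀ q a, ∃! q', A.trans q a q'

/-- `r` is the sequence of states of a run over the word `w`. -/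
def IsRun (A : WeightedAutomaton α) (w : ℕ → α) (r : ℕ → A.State) : Prop :=
  r 0 = A.init ∧ ∀ i, A.trans (r i) (w i) (r (i + 1))

/-- The sequence of weights along a run. -/
def weights (A : WeightedAutomaton α) (w : ℕ → α) (r : ℕ → A.State) (i : ℕ) : ℝ :=
  (A.wt (r i) (w i) (r (i + 1)) : ℝ)

/-- The quantitative language of `A`: the supremum of the values of the runs over the word. -/
noncomputable def lang (A : WeightedAutomaton α) (m : Mode) : QuantLang α :=
  fun w => sSup {x | ∃ r, A.IsRun w r ∧ x = m.val (A.weights w r)}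

end WeightedAutomaton

/-- Positive Boolean formulas over `β`, without constants. -/
inductive PosBool (β : Type) where
  | atom (b : β)
  | conj (φ ψ : PosBool β)
  | disj (φ ψ : PosBool β)

/-- The formula `φ` holds when exactly the atoms in `S` are true. -/
def PosBool.Sat {β : Type} (S : Set β) : PosBool β → Prop
  | .atom b => b ∈ S
  | .conj φ ψ => φ.Sat S ∧ ψ.Sat S
  | .disj φ ψ => φ.Sat S ∨ ψ.Sat S

/-- An alternating weighted automaton over `α`. In state `q`, on letter `a`, the first player
chooses a set of states that satisfies `trans q a`, and the second player chooses the next state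
in it. A state whose formulas are disjunctions of atoms belongs to the first player, and one whose
formulas are conjunctions of atoms belongs to the second player. -/
structure AltAutomaton (α : Type) where
  State : Type
  finite : Finite State
  init : State
  trans : State → α → PosBool State
  wt : State → α → State → ℚ

namespace AltAutomaton

variable {α : Type}

/-- A strategy of the first player over the word `w` (equivalently, a run tree over `w`): to each
list `h` of earlier states and each current state `q` it assigns a set of states that satisfies the
transition formula of `q` for the current letter, which is `w h.length`. -/
def Strategy (B : AltAutomaton α) (w : ℕ → α) : Type :=
  {s : List B.State → B.State → Set B.State // ∀ h q, (B.trans q (w h.length)).Sat (s h q)}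

/-- The sequences of states that the second player can produce against the strategy `s`
(equivalently, the branches of the run tree). -/
def Outcome (B : AltAutomaton α) (w : ℕ → α) (s : B.Strategy w) : Type :=
  {r : ℕ → B.State // r 0 = B.init ∧
    ∀ i, r (i + 1) ∈ s.1 (List.ofFn fun j : Fin i => r j) (r i)}

/-- The sequence of weights along an outcome. -/
def weights (B : AltAutomaton α) (w : ℕ → α) (r : ℕ → B.State) (i : ℕ) : ℝ :=
  (B.wt (r i) (w i) (r (i + 1)) : ℝ)

/-- The quantitative language of `B`: the best value that the first player can enforce. -/
noncomputable def lang (B : AltAutomaton α) (m : Mode) : QuantLang α :=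
  fun w => ⨆ s : B.Strategy w, ⨅ r : B.Outcome w s, m.val (B.weights w r.1)

end AltAutomaton

/-- Mean-payoff automaton expressions over `α`. -/
inductive Expression (α : Type) where
  | aut (m : Mode) (A : WeightedAutomaton α) (hA : A.IsDeterministic)
  | maxOf (E₁ E₂ : Expression α)
  | minOf (E₁ E₂ : Expression α)
  | sumOf (E₁ E₂ : Expression α)

/-- The quantitative language of an expression. -/
noncomputable def Expression.lang {α : Type} : Expression α → QuantLang α
  | .aut m A _ => A.lang m
  | .maxOf E₁ E₂ => fun w => max (E₁.lang w) (E₂.lang w)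
  | .minOf E₁ E₂ => fun w => min (E₁.lang w) (E₂.lang w)
  | .sumOf E₁ E₂ => fun w => E₁.lang w + E₂.lang w

/-- The two-letter alphabet. -/
inductive Letter where
  | a
  | b

open Classical in
/-- The language of finitely many `a`'s. -/
noncomputable def finitelyManyA : QuantLang Letter :=
  fun w => if {i | w i = Letter.a}.Finite then 1 else 0

end MeanPayoff

namespace MeanPayoff

section Averages

variable {v : ℕ → ℝ} {W c C : ℝ}

theorem abs_avg_le (hv : ∀ i, |v i| ≤ W) (n : ℕ) : |avg v n| ≤ W := by
  have hW : 0 ≤ W := (abs_nonneg _).trans (hv 0)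
  rcases Nat.eq_zero_or_pos n with rfl | hn
  · simpa [avg] using hW
  have hn' : (0 : ℝ) < n := by exact_mod_cast hn
  have h : |∑ i ∈ Finset.range n, v i| ≤ n * W := by
    refine (Finset.abs_sum_le_sum_abs _ _).trans ?_
    simpa using Finset.sum_le_sum (s := Finset.range n) fun i _ => hv i
  rw [avg, abs_mul, abs_of_pos (by positivity), one_div, inv_mul_le_iff₀ hn']
  exact h

theorem isBoundedUnder_le_avg (hv : ∀ i, |v i| ≤ W) :
    IsBoundedUnder (· ≤ ·) atTop (avg v) :=
  isBoundedUnder_of ⟨W, fun n => (abs_le.1 (abs_avg_le hv n)).2⟩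

theorem isBoundedUnder_ge_avg (hv : ∀ i, |v i| ≤ W) :
    IsBoundedUnder (· ≥ ·) atTop (avg v) :=
  isBoundedUnder_of ⟨-W, fun n => (abs_le.1 (abs_avg_le hv n)).1⟩

theorem Mode.le_val (m : Mode) (hv : ∀ i, |v i| ≤ W) (h : ∀ᶠ n in atTop, c ≤ avg v n) :
    c ≤ m.val v := by
  cases m with
  | limInfAvg => exact le_liminf_of_le (isBoundedUnder_le_avg hv).isCoboundedUnder_ge h
  | limSupAvg => exact le_limsup_of_frequently_le h.frequently (isBoundedUnder_le_avg hv)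

theorem Mode.val_le (m : Mode) (hv : ∀ i, |v i| ≤ W) (h : ∀ᶠ n in atTop, avg v n ≤ c) :
    m.val v ≤ c := by
  cases m with
  | limInfAvg => exact liminf_le_of_frequently_le h.frequently (isBoundedUnder_ge_avg hv)
  | limSupAvg => exact limsup_le_of_le (isBoundedUnder_ge_avg hv).isCoboundedUnder_le h

theorem Mode.abs_val_le (m : Mode) (hv : ∀ i, |v i| ≤ W) : |m.val v| ≤ W :=
  abs_le.2 ⟨m.le_val hv (.of_forall fun n => (abs_le.1 (abs_avg_le hv n)).1),
    m.val_le hv (.of_forall fun n => (abs_le.1 (abs_avg_le hv n)).2)⟩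

theorem eventually_le_avg_of_le_sum
    (h : ∀ᶠ n : ℕ in atTop, c * n - C ≤ ∑ i ∈ Finset.range n, v i) {ε : ℝ} (hε : 0 < ε) :
    ∀ᶠ n in atTop, c - ε ≤ avg v n := by
  have hC : ∀ᶠ n : ℕ in atTop, C / (n : ℝ) < ε :=
    (tendsto_const_div_atTop_nhds_zero_nat C).eventually_lt_const hε
  filter_upwards [h, hC, eventually_gt_atTop 0] with n h1 h2 hn
  have hn' : (0 : ℝ) < n := by exact_mod_cast hn
  rw [div_lt_iff₀ hn'] at h2
  rw [avg, one_div, le_inv_mul_iff₀ hn']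
  nlinarith

theorem eventually_avg_le_of_sum_le
    (h : ∀ᶠ n : ℕ in atTop, ∑ i ∈ Finset.range n, v i ≤ c * n + C) {ε : ℝ} (hε : 0 < ε) :
    ∀ᶠ n in atTop, avg v n ≤ c + ε := by
  have hC : ∀ᶠ n : ℕ in atTop, C / (n : ℝ) < ε :=
    (tendsto_const_div_atTop_nhds_zero_nat C).eventually_lt_const hε
  filter_upwards [h, hC, eventually_gt_atTop 0] with n h1 h2 hn
  have hn' : (0 : ℝ) < n := by exact_mod_cast hn
  rw [div_lt_iff₀ hn'] at h2
  rw [avg, one_div, inv_mul_le_iff₀ hn']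
  nlinarith

theorem Mode.le_val_of_le_sum (m : Mode) (hv : ∀ i, |v i| ≤ W)
    (h : ∀ᶠ n : ℕ in atTop, c * n - C ≤ ∑ i ∈ Finset.range n, v i) : c ≤ m.val v :=
  le_of_forall_sub_le fun _ hε => m.le_val hv (eventually_le_avg_of_le_sum h hε)

theorem Mode.val_le_of_sum_le (m : Mode) (hv : ∀ i, |v i| ≤ W)
    (h : ∀ᶠ n : ℕ in atTop, ∑ i ∈ Finset.range n, v i ≤ c * n + C) : m.val v ≤ c :=
  le_of_forall_pos_le_add fun _ hε => m.val_le hv (eventually_avg_le_of_sum_le h hε)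

end Averages

section Stages

variable {α : Type} (n : ℕ → ℕ)

/-- The position at which the stage `k` starts, when the stages have the lengths `n`. -/
def stageStart (k : ℕ) : ℕ := ∑ j ∈ Finset.range k, n j

/-- The stage that contains a position, and the offset of the position in that stage. -/
def stagePos : ℕ → ℕ × ℕ
  | 0 => (0, 0)
  | m + 1 => if (stagePos m).2 + 1 < n (stagePos m).1 then ((stagePos m).1, (stagePos m).2 + 1)
      else ((stagePos m).1 + 1, 0)

theorem stageStart_zero : stageStart n 0 = 0 := rfl

theorem stageStart_succ (k : ℕ) : stageStart n (k + 1) = stageStart n k + n k :=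
  Finset.sum_range_succ _ _

theorem stageStart_const (l k : ℕ) : stageStart (fun _ => l) k = k * l := by
  simp [stageStart]

variable {n}

theorem le_stageStart (hn : ∀ k, 0 < n k) (k : ℕ) : k ≤ stageStart n k := by
  induction k with
  | zero => simp
  | succ k ih => have := hn k; rw [stageStart_succ]; omega

theorem stageStart_mono (n : ℕ → ℕ) : Monotone (stageStart n) :=
  monotone_nat_of_le_succ fun k => by rw [stageStart_succ]; omega

theorem stagePos_spec (hn : ∀ k, 0 < n k) (m : ℕ) :
    (stagePos n m).2 < n (stagePos n m).1 ∧
      m = stageStart n (stagePos n m).1 + (stagePos n m).2 := by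
  induction m with
  | zero => simpa [stagePos, stageStart] using hn 0
  | succ m ih =>
    rw [stagePos]
    split_ifs with h
    · exact ⟨h, by simp only; omega⟩
    · refine ⟨hn _, ?_⟩
      simp only [stageStart_succ]
      omega

theorem stagePos_eq (hn : ∀ k, 0 < n k) (k i : ℕ) (hi : i < n k) :
    stagePos n (stageStart n k + i) = (k, i) := by
  induction k generalizing i with
  | zero =>
    induction i with
    | zero => simp [stagePos, stageStart]
    | succ i ih => rw [← add_assoc, stagePos, ih (by omega)]; simp [hi]
  | succ k ihk =>
    induction i with
    | zero =>
      have h := hn k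
      have : stageStart n (k + 1) + 0 = stageStart n k + (n k - 1) + 1 := by
        rw [stageStart_succ]; omega
      rw [this, stagePos, ihk _ (by omega)]
      simp only
      rw [if_neg (by omega)]
    | succ i ih => rw [← add_assoc, stagePos, ih (by omega)]; simp [hi]

/-- The infinite word whose stage `k` consists of the first `n k` letters of `v k`. -/
def stageWord (n : ℕ → ℕ) (v : ℕ → ℕ → α) (m : ℕ) : α := v (stagePos n m).1 (stagePos n m).2

theorem stageWord_apply (hn : ∀ k, 0 < n k) (v : ℕ → ℕ → α) {k i : ℕ} (hi : i < n k) :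
    stageWord n v (stageStart n k + i) = v k i := by
  rw [stageWord, stagePos_eq hn k i hi]

theorem exists_stage (hn : ∀ k, 0 < n k) (m : ℕ) : ∃ k i, i < n k ∧ m = stageStart n k + i :=
  ⟨_, _, stagePos_spec hn m⟩

end Stages

theorem PosBool.sat_univ {β : Type} (φ : PosBool β) : φ.Sat Set.univ := by
  induction φ with
  | atom b => trivial
  | conj φ ψ h₁ h₂ => exact ⟨h₁, h₂⟩
  | disj φ ψ h₁ h₂ => exact Or.inl h₁

theorem PosBool.Sat.nonempty {β : Type} {S : Set β} {φ : PosBool β} (h : φ.Sat S) :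
    S.Nonempty := by
  induction φ with
  | atom b => exact ⟨b, h⟩
  | conj φ ψ h₁ h₂ => exact h₁ h.1
  | disj φ ψ h₁ h₂ => exact h.elim h₁ h₂

namespace AltAutomaton

variable {α : Type} (B : AltAutomaton α)

/-- Reading `n` letters of `w` from position `t` on, the first player can force from the state `q`
that the pair of the final state and the accumulated weight lies in `U`. -/
def Forces (w : ℕ → α) : ℕ → ℕ → B.State → Set (B.State × ℝ) → Prop
  | _, 0, q, U => (q, 0) ∈ U
  | t, n + 1, q, U => ∃ S, (B.trans q (w t)).Sat S ∧
      ∀ q' ∈ S, Forces w (t + 1) n q' {p | (p.1, (B.wt q (w t) q' : ℝ) + p.2) ∈ U}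

variable {B}

theorem forces_congr {w w' : ℕ → α} {n t t' : ℕ} (h : ∀ i < n, w (t + i) = w' (t' + i))
    {q : B.State} {U : Set (B.State × ℝ)} : B.Forces w t n q U ↔ B.Forces w' t' n q U := by
  induction n generalizing t t' q U with
  | zero => rfl
  | succ n ih =>
    have h0 : w t = w' t' := h 0 (by omega)
    have h1 : ∀ i < n, w (t + 1 + i) = w' (t' + 1 + i) := fun i hi => by
      have := h (i + 1) (by omega)
      rwa [add_comm i 1, ← add_assoc, ← add_assoc] at this
    simp only [Forces, h0, ih h1]

theorem Forces.mono {w : ℕ → α} {n t : ℕ} {q : B.State} {U V : Set (B.State × ℝ)} (hUV : U ⊆ V)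
    (h : B.Forces w t n q U) : B.Forces w t n q V := by
  induction n generalizing t q U V with
  | zero => exact hUV h
  | succ n ih =>
    obtain ⟨S, hS, h⟩ := h
    exact ⟨S, hS, fun q' hq' => ih (fun p hp => hUV hp) (h q' hq')⟩

theorem exists_strategy_of_memory {X : Type} (w : ℕ → α) (st : ℕ → X → B.State)
    (Inv : ℕ → X → Prop) (step : ℕ → X → X → Prop) (x₀ : X) (h₀ : st 0 x₀ = B.init)
    (hI : Inv 0 x₀)
    (H : ∀ n x, Inv n x → ∃ S, (B.trans (st n x) (w n)).Sat S ∧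
      ∀ q' ∈ S, ∃ x', st (n + 1) x' = q' ∧ Inv (n + 1) x' ∧ step n x x') :
    ∃ s : B.Strategy w, ∀ r : B.Outcome w s, ∃ x : ℕ → X, x 0 = x₀ ∧
      ∀ n, st n (x n) = r.1 n ∧ Inv n (x n) ∧ step n (x n) (x (n + 1)) := by
  classical
  have H' : ∀ n x, ∃ (S : Set B.State) (nxt : B.State → X), (B.trans (st n x) (w n)).Sat S ∧
      (Inv n x → ∀ q' ∈ S, st (n + 1) (nxt q') = q' ∧ Inv (n + 1) (nxt q') ∧
        step n x (nxt q')) := by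
    intro n x
    by_cases hx : Inv n x
    · obtain ⟨S, hS, h⟩ := H n x hx
      have h' : ∀ q', ∃ x', q' ∈ S → st (n + 1) x' = q' ∧ Inv (n + 1) x' ∧ step n x x' := by
        intro q'
        by_cases hq : q' ∈ S
        · obtain ⟨x', hx'⟩ := h q' hq
          exact ⟨x', fun _ => hx'⟩
        · exact ⟨x, fun hq' => (hq hq').elim⟩
      choose nxt hnxt using h'
      exact ⟨S, nxt, hS, fun _ => hnxt⟩
    · exact ⟨Set.univ, fun _ => x, PosBool.sat_univ _, fun h => (hx h).elim⟩
  choose S nxt hS hnxt using H'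
  let mem : (ℕ → B.State) → ℕ → X := fun r n => Nat.rec x₀ (fun i x => nxt i x (r (i + 1))) n
  have mem_congr : ∀ r r' : ℕ → B.State, ∀ n, (∀ i ≤ n, r i = r' i) → mem r n = mem r' n := by
    intro r r' n
    induction n with
    | zero => intro _; rfl
    | succ n ih =>
      intro h
      change nxt n (mem r n) (r (n + 1)) = nxt n (mem r' n) (r' (n + 1))
      rw [ih fun i hi => h i (by omega), h (n + 1) le_rfl]
  let rd : List B.State → B.State → ℕ → B.State := fun h q i => (h ++ [q]).getD i q
  let s : List B.State → B.State → Set B.State := fun h q =>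
    if q = st h.length (mem (rd h q) h.length) then S h.length (mem (rd h q) h.length)
    else Set.univ
  have hs : ∀ h q, (B.trans q (w h.length)).Sat (s h q) := by
    intro h q
    simp only [s]
    split_ifs with hq
    · have := hS h.length (mem (rd h q) h.length)
      rwa [← hq] at this
    · exact PosBool.sat_univ _
  refine ⟨⟨s, hs⟩, fun r => ⟨mem r.1, rfl, ?_⟩⟩
  have hrd : ∀ n, mem (rd (List.ofFn fun j : Fin n => r.1 j) (r.1 n)) n = mem r.1 n := by
    intro n
    refine mem_congr _ _ _ fun i hi => ?_
    simp only [rd]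
    rcases hi.lt_or_eq with h | rfl
    · rw [List.getD_append _ _ _ _ (by simpa using h)]
      simp [List.getD, h]
    · rw [List.getD_append_right _ _ _ _ (by simp)]
      simp
  have key : ∀ n, st n (mem r.1 n) = r.1 n → Inv n (mem r.1 n) →
      st (n + 1) (mem r.1 (n + 1)) = r.1 (n + 1) ∧ Inv (n + 1) (mem r.1 (n + 1)) ∧
        step n (mem r.1 n) (mem r.1 (n + 1)) := by
    intro n h1 h2
    have h3 := r.2.2 n
    simp only [s, List.length_ofFn, hrd, h1, if_true] at h3
    exact hnxt n _ h2 _ h3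
  have all : ∀ n, st n (mem r.1 n) = r.1 n ∧ Inv n (mem r.1 n) := by
    intro n
    induction n with
    | zero => exact ⟨h₀.trans r.2.1.symm, hI⟩
    | succ n ih => exact ⟨(key n ih.1 ih.2).1, (key n ih.1 ih.2).2.1⟩
  exact fun n => ⟨(all n).1, (all n).2, (key n (all n).1 (all n).2).2.2⟩

theorem exists_strategy_of_stages {X : Type} (w : ℕ → α) {n : ℕ → ℕ} (hn : ∀ k, 0 < n k)
    (st : ℕ → X → B.State) (Inv : ℕ → X → Prop) (step : ℕ → X → ℝ → X → Prop) (x₀ : X)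
    (h₀ : st 0 x₀ = B.init) (hI : Inv 0 x₀)
    (H : ∀ k x, Inv k x → B.Forces w (stageStart n k) (n k) (st k x)
      {p | ∃ x', st (k + 1) x' = p.1 ∧ Inv (k + 1) x' ∧ step k x p.2 x'}) :
    ∃ s : B.Strategy w, ∀ r : B.Outcome w s, ∃ x : ℕ → X, x 0 = x₀ ∧
      ∀ k, Inv k (x k) ∧ step k (x k)
        (∑ i ∈ Finset.range (n k), B.weights w r.1 (stageStart n k + i)) (x (k + 1)) := by
  let goal : ℕ → X → B.State → ℝ → Prop := fun k x q y =>
    ∃ x', st (k + 1) x' = q ∧ Inv (k + 1) x' ∧ step k x y x'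
  obtain ⟨s, hs⟩ := exists_strategy_of_memory (B := B) (X := X × B.State × ℝ) w
    (fun _ z => z.2.1)
    (fun m z => B.Forces w m (n (stagePos n m).1 - (stagePos n m).2) z.2.1
        {p | goal (stagePos n m).1 z.1 p.1 (z.2.2 + p.2)} ∧ Inv (stagePos n m).1 z.1)
    (fun m z z' =>
      if (stagePos n m).2 + 1 < n (stagePos n m).1 then
        z'.1 = z.1 ∧ z'.2.2 = z.2.2 + B.wt z.2.1 (w m) z'.2.1
      else z'.2.2 = 0 ∧ step (stagePos n m).1 z.1 (z.2.2 + B.wt z.2.1 (w m) z'.2.1) z'.1)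
    (x₀, B.init, 0) rfl
    (by
      refine ⟨?_, hI⟩
      simpa [h₀, stagePos, stageStart_zero, goal] using H 0 x₀ hI)
    (by
      rintro m ⟨x, q, y⟩ ⟨hF, hx⟩
      obtain ⟨hi, hm⟩ := stagePos_spec hn m
      have hsucc : stagePos n (m + 1) = if (stagePos n m).2 + 1 < n (stagePos n m).1 then
          ((stagePos n m).1, (stagePos n m).2 + 1) else ((stagePos n m).1 + 1, 0) := rfl
      generalize stagePos n m = ki at *
      obtain ⟨k, i⟩ := ki
      simp only at *
      obtain ⟨l, hl⟩ : ∃ l, n k - i = l + 1 := ⟨n k - i - 1, by omega⟩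
      rw [hl] at hF
      obtain ⟨S, hS, hF⟩ := hF
      refine ⟨S, hS, fun q' hq' => ?_⟩
      have hF' := hF q' hq'
      by_cases hik : i + 1 < n k
      · rw [if_pos hik] at hsucc
        refine ⟨(x, q', y + B.wt q (w m) q'), rfl, ⟨?_, ?_⟩, ?_⟩
        · rw [hsucc]
          have : n k - (i + 1) = l := by omega
          simp only [this]
          refine hF'.mono fun p hp => ?_
          simpa [add_assoc] using hp
        · rw [hsucc]; exact hx
        · rw [if_pos hik]; exact ⟨rfl, rfl⟩
      · rw [if_neg hik] at hsucc
        have : l = 0 := by omega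
        subst this
        obtain ⟨x', h1, h2, h3⟩ := hF'
        simp only [add_zero] at h1 h3
        refine ⟨(x', q', 0), rfl, ⟨?_, ?_⟩, ?_⟩
        · rw [hsucc]
          have hm' : m + 1 = stageStart n (k + 1) := by rw [stageStart_succ]; omega
          have := H (k + 1) x' h2
          rw [h1] at this
          simpa [hm', goal] using this
        · rw [hsucc]; exact h2
        · rw [if_neg hik]; exact ⟨rfl, h3⟩)
  refine ⟨s, fun r => ?_⟩
  obtain ⟨z, hz0, hz⟩ := hs r
  refine ⟨fun k => (z (stageStart n k)).1, by simp [stageStart_zero, hz0], fun k => ?_⟩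
  have hstart : ∀ k, (z (stageStart n k)).2.2 = 0 := by
    intro k
    cases k with
    | zero => simp [stageStart_zero, hz0]
    | succ k =>
      have h1 := (hz (stageStart n k + (n k - 1))).2.2
      have h2 := hn k
      rw [stagePos_eq hn k _ (by omega)] at h1
      simp only at h1
      rw [if_neg (by omega)] at h1
      have : stageStart n k + (n k - 1) + 1 = stageStart n (k + 1) := by
        rw [stageStart_succ]; omega
      rw [this] at h1
      exact h1.1
  have hin : ∀ i < n k, (z (stageStart n k + i)).1 = (z (stageStart n k)).1 ∧
      (z (stageStart n k + i)).2.2 =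
        ∑ j ∈ Finset.range i, B.weights w r.1 (stageStart n k + j) := by
    intro i
    induction i with
    | zero => intro _; simp [hstart]
    | succ i ih =>
      intro hi
      obtain ⟨h1, h2⟩ := ih (by omega)
      have h3 := (hz (stageStart n k + i)).2.2
      rw [stagePos_eq hn k _ (by omega)] at h3
      simp only at h3
      rw [if_pos hi, h1, h2, (hz _).1, (hz _).1] at h3
      refine ⟨h3.1, ?_⟩
      rw [Finset.sum_range_succ, ← add_assoc]
      exact h3.2
  have hk := hn k
  constructor
  · have := (hz (stageStart n k + 0)).2.1.2
    rw [stagePos_eq hn k 0 hk] at this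
    exact this
  · have h3 := (hz (stageStart n k + (n k - 1))).2.2
    obtain ⟨h1, h2⟩ := hin (n k - 1) (by omega)
    rw [stagePos_eq hn k _ (by omega)] at h3
    simp only at h3
    rw [if_neg (by omega), h1, h2, (hz _).1, (hz _).1] at h3
    have e1 : stageStart n k + (n k - 1) + 1 = stageStart n (k + 1) := by
      rw [stageStart_succ]; omega
    have e2 : n k - 1 + 1 = n k := by omega
    have e3 : ∑ i ∈ Finset.range (n k), B.weights w r.1 (stageStart n k + i) =
        ∑ j ∈ Finset.range (n k - 1), B.weights w r.1 (stageStart n k + j) +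
          B.wt (r.1 (stageStart n k + (n k - 1))) (w (stageStart n k + (n k - 1)))
            (r.1 (stageStart n k + (n k - 1) + 1)) := by
      conv_lhs => rw [← e2, Finset.sum_range_succ]
      rfl
    rw [e3]
    rw [e1] at h3 ⊢
    exact h3.2

/-- The first `t` steps of `r` are consistent with the strategy `s`. -/
def Consistent {w : ℕ → α} (s : B.Strategy w) (r : ℕ → B.State) (t : ℕ) : Prop :=
  r 0 = B.init ∧ ∀ i < t, r (i + 1) ∈ s.1 (List.ofFn fun j : Fin i => r j) (r i)

theorem Consistent.congr {w : ℕ → α} {s : B.Strategy w} {r r' : ℕ → B.State} {t : ℕ}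
    (h : Consistent s r t) (hr : ∀ i ≤ t, r' i = r i) : Consistent s r' t := by
  refine ⟨(hr 0 (by omega)).trans h.1, fun i hi => ?_⟩
  have : (fun j : Fin i => r' j) = fun j : Fin i => r j :=
    funext fun j => hr j (by have := j.2; omega)
  rw [this, hr i (by omega), hr (i + 1) (by omega)]
  exact h.2 i hi

theorem forces_of_consistent {w : ℕ → α} (s : B.Strategy w) (n : ℕ) {r : ℕ → B.State} {t : ℕ}
    (h : Consistent s r t) :
    B.Forces w t n (r t) {p | ∃ r', (∀ i ≤ t, r' i = r i) ∧ Consistent s r' (t + n) ∧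
      r' (t + n) = p.1 ∧ ∑ i ∈ Finset.range n, B.weights w r' (t + i) = p.2} := by
  induction n generalizing r t with
  | zero => exact ⟨r, fun _ _ => rfl, h, rfl, by simp⟩
  | succ n ih =>
    refine ⟨s.1 (List.ofFn fun j : Fin t => r j) (r t), ?_, fun q' hq' => ?_⟩
    · simpa using s.2 (List.ofFn fun j : Fin t => r j) (r t)
    · set r₁ := Function.update r (t + 1) q' with hr₁
      have e : ∀ i ≤ t, r₁ i = r i := fun i hi => by
        rw [hr₁, Function.update_of_ne (by omega)]
      have e1 : r₁ (t + 1) = q' := by simp [hr₁]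
      have h₁ : Consistent s r₁ (t + 1) := by
        refine ⟨(h.congr e).1, fun i hi => ?_⟩
        rcases Nat.lt_succ_iff_lt_or_eq.1 hi with hi | rfl
        · exact (h.congr e).2 i hi
        · have : (fun j : Fin i => r₁ j) = fun j : Fin i => r j :=
            funext fun j => e j (by have := j.2; omega)
          rw [this, e i le_rfl, e1]
          exact hq'
      have := ih h₁
      rw [e1] at this
      refine this.mono ?_
      rintro ⟨p, y⟩ ⟨r', h1, h2, h3, h4⟩
      refine ⟨r', fun i hi => (h1 i (by omega)).trans (e i hi), ?_, ?_, ?_⟩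
      · rwa [← add_assoc, add_right_comm]
      · rwa [← add_assoc, add_right_comm]
      · rw [Finset.sum_range_succ', ← h4, add_comm]
        congr 1
        · rw [weights, add_zero, h1 (t + 1) le_rfl, h1 t (by omega), e1, e t le_rfl]
        · exact Finset.sum_congr rfl fun i _ => by rw [add_assoc, add_comm 1 i]

/-- If each stage of `w'` can be simulated by the same stage of `w` up to the invariant `c` of the
average weight, then each strategy over `w'` can be simulated by a strategy over `w`. -/
theorem exists_simulation {C : Type} (c : ℝ → C) {w w' : ℕ → α} {n n' : ℕ → ℕ}
    (hn : ∀ k, 0 < n k) (hn' : ∀ k, 0 < n' k)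
    (H : ∀ k q (U : Set (B.State × C)),
      B.Forces w' (stageStart n' k) (n' k) q {p | (p.1, c (p.2 / n' k)) ∈ U} →
      B.Forces w (stageStart n k) (n k) q {p | (p.1, c (p.2 / n k)) ∈ U})
    (s' : B.Strategy w') :
    ∃ s : B.Strategy w, ∀ r : B.Outcome w s, ∃ r' : B.Outcome w' s', ∀ k,
      c ((∑ i ∈ Finset.range (n k), B.weights w r.1 (stageStart n k + i)) / n k) =
      c ((∑ i ∈ Finset.range (n' k), B.weights w' r'.1 (stageStart n' k + i)) / n' k) := by
  obtain ⟨s, hs⟩ := exists_strategy_of_stages (B := B) (X := ℕ → B.State) w hn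
    (fun k r => r (stageStart n' k)) (fun k r => Consistent s' r (stageStart n' k))
    (fun k r y r' => (∀ i ≤ stageStart n' k, r' i = r i) ∧ c (y / n k) =
      c ((∑ i ∈ Finset.range (n' k), B.weights w' r' (stageStart n' k + i)) / n' k))
    (fun _ => B.init) rfl ⟨rfl, fun i hi => by simp [stageStart_zero] at hi⟩
    (by
      intro k r hr
      refine (H k (r (stageStart n' k)) {x | ∃ r', r' (stageStart n' (k + 1)) = x.1 ∧
        Consistent s' r' (stageStart n' (k + 1)) ∧ (∀ i ≤ stageStart n' k, r' i = r i) ∧ x.2 =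
        c ((∑ i ∈ Finset.range (n' k), B.weights w' r' (stageStart n' k + i)) / n' k)} ?_).mono ?_
      · refine (forces_of_consistent s' (n' k) hr).mono ?_
        rintro ⟨p, y⟩ ⟨r', h1, h2, h3, h4⟩
        rw [← stageStart_succ] at h2 h3
        exact ⟨r', h3, h2, h1, by rw [h4]⟩
      · rintro ⟨p, y⟩ ⟨r', h1, h2, h3, h4⟩
        exact ⟨r', h1, h2, h3, h4⟩)
  refine ⟨s, fun r => ?_⟩
  obtain ⟨x, hx0, hx⟩ := hs r
  have agree : ∀ k l, k ≤ l → ∀ i ≤ stageStart n' k, x l i = x k i := by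
    intro k l hkl
    induction l, hkl using Nat.le_induction with
    | base => exact fun _ _ => rfl
    | succ l hkl ih =>
      intro i hi
      rw [(hx l).2.1 i (hi.trans (stageStart_mono n' hkl)), ih i hi]
  let r' : ℕ → B.State := fun i => x i i
  have hr' : ∀ k, ∀ i ≤ stageStart n' k, r' i = x k i := by
    intro k i hi
    rcases le_total k i with h | h
    · exact agree k i h i hi
    · exact (agree i k h i (le_stageStart hn' i)).symm
  refine ⟨⟨r', ?_, fun i => ?_⟩, fun k => ?_⟩
  · exact ((hx 0).1.congr (hr' 0)).1
  · have := le_stageStart hn' (i + 1)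
    exact ((hx (i + 1)).1.congr (hr' (i + 1))).2 i (by omega)
  · rw [(hx k).2.2]
    congr 2
    refine Finset.sum_congr rfl fun i hi => ?_
    have hi := Finset.mem_range.1 hi
    change (B.wt _ _ _ : ℝ) = B.wt (r' (stageStart n' k + i)) _ (r' (stageStart n' k + i + 1))
    rw [hr' (k + 1) _ (by rw [stageStart_succ]; omega),
      hr' (k + 1) _ (by rw [stageStart_succ]; omega)]

end AltAutomaton

instance : Finite Letter :=
  Finite.of_surjective (fun x : Bool => if x then Letter.a else Letter.b) fun l => by
    cases l
    · exact ⟨true, rfl⟩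
    · exact ⟨false, rfl⟩

theorem exists_forall_abs_le {β : Type} [Finite β] (f : β → ℝ) : ∃ W, ∀ b, |f b| ≤ W := by
  obtain ⟨W, hW⟩ := (Set.finite_range fun b => |f b|).bddAbove
  exact ⟨W, fun b => hW ⟨b, rfl⟩⟩

/-- A bounded interval can be partitioned into finitely many cells of diameter at most `ε`. -/
theorem exists_finite_cells (W : ℝ) {ε : ℝ} (hε : 0 < ε) :
    ∃ (C : Type) (_ : Finite C) (c : ℝ → C),
      ∀ x y, |x| ≤ W → |y| ≤ W → c x = c y → |x - y| ≤ ε := by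
  obtain ⟨M, hM⟩ := exists_nat_gt (W / ε + 1)
  have hM0 : (-(M : ℤ)) ≤ M := by omega
  have mem : ∀ x, |x| ≤ W → ⌊x / ε⌋ ∈ Set.Icc (-(M : ℤ)) M := by
    intro x hx
    obtain ⟨h1, h2⟩ := abs_le.1 hx
    have h3 : x / ε ≤ W / ε := by gcongr
    have h4 : -(W / ε) ≤ x / ε := by rw [← neg_div]; gcongr
    constructor
    · rw [Int.le_floor]; push_cast; linarith
    · have := Int.floor_le (x / ε)
      have : ((⌊x / ε⌋ : ℤ) : ℝ) ≤ ((M : ℤ) : ℝ) := by push_cast; linarith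
      exact_mod_cast this
  refine ⟨Set.Icc (-(M : ℤ)) M, inferInstance, fun x => Set.projIcc _ _ hM0 ⌊x / ε⌋, ?_⟩
  intro x y hx hy hxy
  beta_reduce at hxy
  rw [Set.projIcc_of_mem hM0 (mem x hx), Set.projIcc_of_mem hM0 (mem y hy), Subtype.mk.injEq] at hxy
  have h := Int.abs_sub_lt_one_of_floor_eq_floor hxy
  rw [← sub_div, abs_div, abs_of_pos hε, div_lt_one hε] at h
  exact h.le

section StageAverages

variable {v : ℕ → ℝ} {W c : ℝ}

/-- The sum of a sequence over the stage `k`. -/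
def stageSum (v : ℕ → ℝ) (n : ℕ → ℕ) (k : ℕ) : ℝ :=
  ∑ i ∈ Finset.range (n k), v (stageStart n k + i)

theorem abs_sum_add_le (hv : ∀ i, |v i| ≤ W) (t n : ℕ) :
    |∑ i ∈ Finset.range n, v (t + i)| ≤ n * W := by
  refine (Finset.abs_sum_le_sum_abs _ _).trans ?_
  simpa using Finset.sum_le_sum (s := Finset.range n) fun i _ => hv (t + i)

theorem abs_stageSum_div_le (hv : ∀ i, |v i| ≤ W) {n : ℕ → ℕ} (hn : ∀ k, 0 < n k) (k : ℕ) :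
    |stageSum v n k / n k| ≤ W := by
  have : (0 : ℝ) < n k := by exact_mod_cast hn k
  rw [abs_div, abs_of_pos this, div_le_iff₀ this, mul_comm]
  exact abs_sum_add_le hv _ _

theorem eventually_le_sum_of_stageSum (hv : ∀ i, |v i| ≤ W) {l : ℕ} (hl : 0 < l)
    (h : ∀ᶠ k in atTop, c ≤ stageSum v (fun _ => l) k / l) :
    ∃ C, ∀ᶠ m : ℕ in atTop, c * m - C ≤ ∑ i ∈ Finset.range m, v i := by
  obtain ⟨k₀, hk₀⟩ := eventually_atTop.1 h
  have hl' : (0 : ℝ) < l := by exact_mod_cast hl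
  let g : ℕ → ℝ := fun k => ∑ i ∈ Finset.range (k * l), v i - c * (k * l : ℕ)
  have hg : ∀ k, k₀ ≤ k → g k₀ ≤ g k := by
    intro k hk
    induction k, hk using Nat.le_induction with
    | base => exact le_rfl
    | succ k hk ih =>
      refine ih.trans ?_
      have := hk₀ k hk
      rw [le_div_iff₀ hl', stageSum, stageStart_const] at this
      simp only [g, add_mul, one_mul, Finset.sum_range_add, Nat.cast_add]
      linarith
  refine ⟨l * W + |c| * l - g k₀, eventually_atTop.2 ⟨k₀ * l, fun m hm => ?_⟩⟩
  have h1 := hg (m / l) ((Nat.le_div_iff_mul_le hl).2 hm)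
  obtain ⟨i, hi⟩ : ∃ i, i = m % l := ⟨_, rfl⟩
  have hil : i < l := hi ▸ Nat.mod_lt m hl
  have hm' : m = m / l * l + i := by rw [hi, mul_comm]; exact (Nat.div_add_mod m l).symm
  have hil' : (i : ℝ) ≤ l := by exact_mod_cast hil.le
  have hW : 0 ≤ W := (abs_nonneg _).trans (hv 0)
  have h2 := (abs_le.1 (abs_sum_add_le hv (m / l * l) i)).1
  have h3 : (i : ℝ) * W ≤ l * W := by gcongr
  have h4 : c * i ≤ |c| * l := (mul_le_mul_of_nonneg_right (le_abs_self c) i.cast_nonneg).trans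
    (mul_le_mul_of_nonneg_left hil' (abs_nonneg c))
  have h5 : c * m = c * (m / l * l : ℕ) + c * i := by
    rw [← mul_add, ← Nat.cast_add, ← hm']
  have h6 : ∑ j ∈ Finset.range m, v j = ∑ j ∈ Finset.range (m / l * l), v j +
      ∑ j ∈ Finset.range i, v (m / l * l + j) := by
    rw [← Finset.sum_range_add, ← hm']
  linarith

theorem Mode.le_val_of_stageSum (m : Mode) (hv : ∀ i, |v i| ≤ W) {l : ℕ} (hl : 0 < l)
    (h : ∀ᶠ k in atTop, c ≤ stageSum v (fun _ => l) k / l) : c ≤ m.val v := by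
  obtain ⟨C, hC⟩ := eventually_le_sum_of_stageSum hv hl h
  exact m.le_val_of_le_sum hv hC

theorem Mode.val_le_of_stageSum (m : Mode) (hv : ∀ i, |v i| ≤ W) {l : ℕ} (hl : 0 < l)
    (h : ∀ᶠ k in atTop, stageSum v (fun _ => l) k / l ≤ c) : m.val v ≤ c := by
  obtain ⟨C, hC⟩ := eventually_le_sum_of_stageSum (v := fun i => -v i) (c := -c)
    (fun i => by simpa using hv i) hl (h.mono fun k hk => by
      simp only [stageSum, Finset.sum_neg_distrib, neg_div, neg_le_neg_iff]
      exact hk)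
  refine m.val_le_of_sum_le (C := C) hv (hC.mono fun k hk => ?_)
  rw [Finset.sum_neg_distrib] at hk
  linarith

theorem abs_avg_sub_stageSum_le (hv : ∀ i, |v i| ≤ W) {n : ℕ → ℕ} (hn : ∀ k, 0 < n k) {k : ℕ}
    {ε : ℝ} (h : 2 * W * stageStart n k ≤ ε * n k) (hε : 0 ≤ ε) :
    |avg v (stageStart n (k + 1)) - stageSum v n k / n k| ≤ ε := by
  have hn' : (0 : ℝ) < n k := by exact_mod_cast hn k
  have ht : (0 : ℝ) ≤ stageStart n k := Nat.cast_nonneg _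
  have h1 := abs_sum_add_le hv 0 (stageStart n k)
  have h2 : |stageSum v n k| ≤ n k * W := abs_sum_add_le hv _ _
  simp only [zero_add] at h1
  rw [avg, stageStart_succ, Finset.sum_range_add]
  change |_ * (_ + stageSum v n k) - _| ≤ ε
  generalize stageSum v n k = P at *
  generalize ∑ i ∈ Finset.range (stageStart n k), v i = S at *
  push_cast
  generalize (stageStart n k : ℝ) = t at *
  generalize (n k : ℝ) = l at *
  have e : 1 / (t + l) * (S + P) - P / l = (S * l - P * t) / ((t + l) * l) := by
    field_simp
    ring
  have h3 : |S * l - P * t| ≤ 2 * W * t * l := by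
    refine (abs_sub _ _).trans ?_
    rw [abs_mul, abs_mul, abs_of_pos hn', abs_of_nonneg ht]
    nlinarith [mul_le_mul_of_nonneg_right h1 hn'.le, mul_le_mul_of_nonneg_right h2 ht]
  rw [e, abs_div, abs_of_pos (by positivity : 0 < (t + l) * l), div_le_iff₀ (by positivity)]
  nlinarith [mul_le_mul_of_nonneg_right h hn'.le, mul_nonneg (mul_nonneg hε ht) hn'.le]

end StageAverages

section Zigzag

variable {α : Type}

/-- The word `p ^ n₀ q ^ n₀ p ^ n₁ q ^ n₁ ⋯`. -/
def zigzag (p q : α) (n : ℕ → ℕ) : ℕ → α :=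
  stageWord (fun k => 2 * n k) fun k i => if i < n k then p else q

theorem zigzag_apply (p q : α) {n : ℕ → ℕ} (hn : ∀ k, 0 < n k) {k i : ℕ} (hi : i < 2 * n k) :
    zigzag p q n (stageStart (fun k => 2 * n k) k + i) = if i < n k then p else q :=
  stageWord_apply (n := fun k => 2 * n k) (fun k => by have := hn k; omega) _ hi

variable {p q : α} {n : ℕ → ℕ} {f : α → ℝ}

theorem sum_zigzag_add (hq : f q = -f p) (hn : ∀ k, 0 < n k) (k : ℕ) {i : ℕ} (hi : i ≤ 2 * n k) :
    ∑ j ∈ Finset.range i, f (zigzag p q n (stageStart (fun k => 2 * n k) k + j)) =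
      f p * if i ≤ n k then (i : ℝ) else 2 * n k - i := by
  induction i with
  | zero => simp
  | succ i ih =>
    rw [Finset.sum_range_succ, ih (by omega), zigzag_apply p q hn (by omega)]
    rcases lt_trichotomy i (n k) with h | h | h
    · rw [if_pos h.le, if_pos h, if_pos (by omega)]
      push_cast
      ring
    · rw [if_pos h.le, if_neg (by omega), if_neg (by omega), hq, h]
      push_cast
      ring
    · rw [if_neg (by omega), if_neg (by omega), if_neg (by omega), hq]
      push_cast
      ring

theorem sum_zigzag_stageStart (hq : f q = -f p) (hn : ∀ k, 0 < n k) (k : ℕ) :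
    ∑ j ∈ Finset.range (stageStart (fun k => 2 * n k) k), f (zigzag p q n j) = 0 := by
  induction k with
  | zero => simp [stageStart_zero]
  | succ k ih =>
    have := hn k
    rw [stageStart_succ, Finset.sum_range_add, ih, sum_zigzag_add hq hn k le_rfl,
      if_neg (by omega)]
    push_cast
    ring

theorem sum_zigzag (hq : f q = -f p) (hn : ∀ k, 0 < n k) (k : ℕ) {i : ℕ} (hi : i ≤ 2 * n k) :
    ∑ j ∈ Finset.range (stageStart (fun k => 2 * n k) k + i), f (zigzag p q n j) =
      f p * if i ≤ n k then (i : ℝ) else 2 * n k - i := by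
  rw [Finset.sum_range_add, sum_zigzag_stageStart hq hn, sum_zigzag_add hq hn k hi, zero_add]

theorem exists_sum_zigzag_eq (hq : f q = -f p) (hn : ∀ k, 0 < n k) (m : ℕ) :
    ∃ k, ∃ x : ℝ, 0 ≤ x ∧ x ≤ n k ∧ ∑ j ∈ Finset.range m, f (zigzag p q n j) = f p * x := by
  obtain ⟨k, i, hi, rfl⟩ := exists_stage (n := fun k => 2 * n k)
    (fun k => by have := hn k; omega) m
  refine ⟨k, _, ?_, ?_, sum_zigzag hq hn k hi.le⟩
  · have : (i : ℝ) ≤ 2 * n k := by exact_mod_cast hi.le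
    split_ifs <;> [positivity; linarith]
  · split_ifs with h
    · exact_mod_cast h
    · have : (n k : ℝ) ≤ i := by exact_mod_cast (not_le.1 h).le
      linarith

theorem Mode.val_zigzag_const (m : Mode) (hq : f q = -f p) {l : ℕ} (hl : 0 < l)
    {W : ℝ} (hf : ∀ x, |f x| ≤ W) : m.val (fun i => f (zigzag p q (fun _ => l) i)) = 0 := by
  have h : ∀ j : ℕ, |∑ i ∈ Finset.range j, f (zigzag p q (fun _ => l) i)| ≤ |f p| * l := by
    intro j
    obtain ⟨_, x, hx0, hx, h⟩ := exists_sum_zigzag_eq (p := p) hq (fun _ => hl) j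
    rw [h, abs_mul, abs_of_nonneg hx0]
    gcongr
  refine le_antisymm (m.val_le_of_sum_le (C := |f p| * l) (fun _ => hf _) (.of_forall fun j => ?_))
    (m.le_val_of_le_sum (C := |f p| * l) (fun _ => hf _) (.of_forall fun j => ?_))
  · linarith [(abs_le.1 (h j)).2]
  · linarith [(abs_le.1 (h j)).1]

theorem frequently_avg_zigzag (hq : f q = -f p) (hn : ∀ k, 0 < n k)
    (hfast : ∀ k, stageStart (fun k => 2 * n k) k ≤ n k) :
    ∃ᶠ m in atTop, ∃ x : ℝ, 1 / 2 ≤ x ∧ avg (fun i => f (zigzag p q n i)) m = f p * x := by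
  refine frequently_atTop.2 fun k => ⟨stageStart (fun k => 2 * n k) k + n k, ?_, ?_⟩
  · have := le_stageStart (n := fun k => 2 * n k) (fun k => by have := hn k; omega) k
    omega
  · have h1 : (stageStart (fun k => 2 * n k) k : ℝ) ≤ n k := by exact_mod_cast hfast k
    have h2 : (0 : ℝ) < n k := by exact_mod_cast hn k
    have h3 : (0 : ℝ) ≤ stageStart (fun k => 2 * n k) k := Nat.cast_nonneg _
    refine ⟨n k / (stageStart (fun k => 2 * n k) k + n k), ?_, ?_⟩
    · rw [div_le_div_iff₀ two_pos (by positivity)]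
      linarith
    · rw [avg, sum_zigzag hq hn k (by omega), if_pos le_rfl]
      push_cast
      ring

end Zigzag

section Balance

/-- The weight `1` for `a` and `-1` for `b`. -/
def Letter.sign : Letter → ℚ
  | .a => 1
  | .b => -1

/-- The automaton with one state that weighs each letter by its sign. -/
def signAutomaton : WeightedAutomaton Letter where
  State := Unit
  finite := inferInstance
  init := ()
  trans _ _ _ := True
  total _ _ := ⟨(), trivial⟩
  wt _ l _ := l.sign

theorem signAutomaton_isDeterministic : signAutomaton.IsDeterministic :=
  fun _ _ => ⟨(), trivial, fun _ _ => rfl⟩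

theorem signAutomaton_lang (m : Mode) (w : ℕ → Letter) :
    signAutomaton.lang m w = m.val fun i => ((w i).sign : ℝ) := by
  have : {x | ∃ r, signAutomaton.IsRun w r ∧ x = m.val (signAutomaton.weights w r)} =
      {m.val fun i => ((w i).sign : ℝ)} := by
    ext x
    constructor
    · rintro ⟨r, -, rfl⟩
      rfl
    · rintro rfl
      exact ⟨fun _ => (), ⟨rfl, fun _ => trivial⟩, rfl⟩
  rw [WeightedAutomaton.lang, this, csSup_singleton]

/-- The sum of the lower and the upper limit-average of the signs of the letters. -/
noncomputable def signLang : QuantLang Letter := fun w =>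
  Mode.limInfAvg.val (fun i => ((w i).sign : ℝ)) + Mode.limSupAvg.val fun i => ((w i).sign : ℝ)

theorem Letter.abs_sign_le (l : Letter) : |(l.sign : ℝ)| ≤ 1 := by
  cases l <;> simp [Letter.sign]

theorem signLang_zigzag_const {p q : Letter} (hq : (q.sign : ℝ) = -p.sign) {l : ℕ} (hl : 0 < l) :
    signLang (zigzag p q fun _ => l) = 0 := by
  have h := fun m => Mode.val_zigzag_const (f := fun l : Letter => (l.sign : ℝ)) m hq hl
    Letter.abs_sign_le
  rw [signLang, h, h, add_zero]

variable {n : ℕ → ℕ}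

theorem half_le_signLang_zigzag (hn : ∀ k, 0 < n k)
    (hfast : ∀ k, stageStart (fun k => 2 * n k) k ≤ n k) :
    1 / 2 ≤ signLang (zigzag .a .b n) := by
  have hq : ((Letter.b.sign : ℚ) : ℝ) = -(Letter.a.sign : ℚ) := by simp [Letter.sign]
  have h1 : 0 ≤ Mode.limInfAvg.val fun i => ((zigzag Letter.a .b n i).sign : ℝ) := by
    refine Mode.le_val_of_le_sum (C := 0) _ (fun _ => Letter.abs_sign_le _) (.of_forall fun m => ?_)
    obtain ⟨k, x, hx, -, h⟩ := exists_sum_zigzag_eq (f := fun l : Letter => (l.sign : ℝ)) hq hn m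
    rw [h]
    simpa [Letter.sign] using hx
  have h2 : 1 / 2 ≤ Mode.limSupAvg.val fun i => ((zigzag Letter.a .b n i).sign : ℝ) := by
    refine le_limsup_of_frequently_le ?_ (isBoundedUnder_le_avg fun _ => Letter.abs_sign_le _)
    refine (frequently_avg_zigzag (f := fun l : Letter => (l.sign : ℝ)) hq hn hfast).mono ?_
    rintro m ⟨x, hx, h⟩
    rw [h]
    simpa [Letter.sign] using hx
  rw [signLang]
  linarith

theorem signLang_zigzag_le_neg_half (hn : ∀ k, 0 < n k)
    (hfast : ∀ k, stageStart (fun k => 2 * n k) k ≤ n k) :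
    signLang (zigzag .b .a n) ≤ -(1 / 2) := by
  have hq : ((Letter.a.sign : ℚ) : ℝ) = -(Letter.b.sign : ℚ) := by simp [Letter.sign]
  have h1 : (Mode.limSupAvg.val fun i => ((zigzag Letter.b .a n i).sign : ℝ)) ≤ 0 := by
    refine Mode.val_le_of_sum_le (C := 0) _ (fun _ => Letter.abs_sign_le _) (.of_forall fun m => ?_)
    obtain ⟨k, x, hx, -, h⟩ := exists_sum_zigzag_eq (f := fun l : Letter => (l.sign : ℝ)) hq hn m
    rw [h]
    simpa [Letter.sign] using hx
  have h2 : (Mode.limInfAvg.val fun i => ((zigzag Letter.b .a n i).sign : ℝ)) ≤ -(1 / 2) := by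
    refine liminf_le_of_frequently_le ?_ (isBoundedUnder_ge_avg fun _ => Letter.abs_sign_le _)
    refine (frequently_avg_zigzag (f := fun l : Letter => (l.sign : ℝ)) hq hn hfast).mono ?_
    rintro m ⟨x, hx, h⟩
    rw [h]
    simp only [Letter.sign]
    push_cast
    linarith
  rw [signLang]
  linarith

end Balance

namespace AltAutomaton

variable {α : Type} {B : AltAutomaton α}

theorem exists_abs_weights_le [Finite α] (B : AltAutomaton α) :
    ∃ W, ∀ w r i, |B.weights w r i| ≤ W := by
  have := B.finite
  obtain ⟨W, hW⟩ := exists_forall_abs_le fun x : B.State × α × B.State => (B.wt x.1 x.2.1 x.2.2 : ℝ)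
  exact ⟨W, fun w r i => hW (r i, w i, r (i + 1))⟩

instance (w : ℕ → α) : Nonempty (B.Strategy w) :=
  ⟨⟨fun _ _ => Set.univ, fun _ _ => PosBool.sat_univ _⟩⟩

/-- If the sets chosen by a strategy meet `T`, then some outcome always moves within `T`. -/
theorem exists_outcome {w : ℕ → α} (s : B.Strategy w) (T : ℕ → B.State → B.State → Prop)
    (hT : ∀ h q, ∃ q' ∈ s.1 h q, T h.length q q') :
    ∃ r : B.Outcome w s, ∀ i, T i (r.1 i) (r.1 (i + 1)) := by
  choose nxt hnxt hT using hT
  let hist : ℕ → List B.State × B.State := fun i =>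
    Nat.rec ([], B.init) (fun _ x => (x.1 ++ [x.2], nxt x.1 x.2)) i
  have hlist : ∀ i, (hist i).1 = List.ofFn fun j : Fin i => (hist j).2 := by
    intro i
    induction i with
    | zero => simp [hist]
    | succ i ih =>
      rw [List.ofFn_succ', List.concat_eq_append]
      change (hist i).1 ++ [(hist i).2] = _
      rw [ih]
      rfl
  refine ⟨⟨fun i => (hist i).2, rfl, fun i => ?_⟩, fun i => ?_⟩
  · rw [← hlist i]
    exact hnxt _ _
  · have := hT (hist i).1 (hist i).2
    rw [hlist, List.length_ofFn, ← hlist] at this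
    exact this

instance (w : ℕ → α) (s : B.Strategy w) : Nonempty (B.Outcome w s) := by
  obtain ⟨r, -⟩ := exists_outcome s (fun _ _ _ => True) fun h q => by
    obtain ⟨q', hq'⟩ := (s.2 h q).nonempty
    exact ⟨q', hq', trivial⟩
  exact ⟨r⟩

theorem bddBelow_range_val [Finite α] (m : Mode) {w : ℕ → α} (s : B.Strategy w) :
    BddBelow (Set.range fun r : B.Outcome w s => m.val (B.weights w r.1)) := by
  obtain ⟨W, hW⟩ := B.exists_abs_weights_le
  refine ⟨-W, ?_⟩
  rintro _ ⟨r, rfl⟩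
  exact (abs_le.1 (m.abs_val_le (hW w r.1))).1

theorem bddAbove_range_iInf_val [Finite α] (m : Mode) (w : ℕ → α) :
    BddAbove (Set.range fun s : B.Strategy w =>
      ⨅ r : B.Outcome w s, m.val (B.weights w r.1)) := by
  obtain ⟨W, hW⟩ := B.exists_abs_weights_le
  refine ⟨W, ?_⟩
  rintro _ ⟨s, rfl⟩
  obtain ⟨r⟩ : Nonempty (B.Outcome w s) := inferInstance
  exact ciInf_le_of_le (bddBelow_range_val m s) r (abs_le.1 (m.abs_val_le (hW w r.1))).2

theorem exists_strategy_of_lt_lang [Finite α] {m : Mode} {w : ℕ → α} {c : ℝ}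
    (h : c < B.lang m w) :
    ∃ s : B.Strategy w, ∀ r : B.Outcome w s, c < m.val (B.weights w r.1) := by
  obtain ⟨s, hs⟩ := exists_lt_of_lt_ciSup h
  exact ⟨s, fun r => hs.trans_le (ciInf_le (bddBelow_range_val m s) r)⟩

theorem le_lang [Finite α] {m : Mode} {w : ℕ → α} {c : ℝ} (s : B.Strategy w)
    (h : ∀ r : B.Outcome w s, c ≤ m.val (B.weights w r.1)) : c ≤ B.lang m w :=
  le_ciSup_of_le (bddAbove_range_iInf_val m w) s (le_ciInf h)

theorem exists_fast_sequence {I : Set ℕ} (hI : I.Infinite) (M : ℕ) :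
    ∃ n : ℕ → ℕ, ∀ k, n k ∈ I ∧ 0 < n k ∧ M * stageStart (fun k => 2 * n k) k ≤ n k := by
  choose g hgI hg using fun m => hI.exists_gt m
  let start : ℕ → ℕ := fun k => Nat.rec 0 (fun _ t => t + 2 * g (M * t)) k
  have hstart : ∀ k, stageStart (fun k => 2 * g (M * start k)) k = start k := by
    intro k
    induction k with
    | zero => rfl
    | succ k ih => rw [stageStart_succ, ih]
  refine ⟨fun k => g (M * start k), fun k => ⟨hgI _, (Nat.zero_le _).trans_lt (hg _), ?_⟩⟩
  rw [hstart]
  exact (hg _).le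

/-- The first player can transfer strategies, up to an error in the averages of the stages, between
a periodic zigzag word and a zigzag word with fast growing stages. -/
theorem exists_transfer (B : AltAutomaton α) (p q : α) (M : ℕ) {W ε : ℝ}
    (hW : ∀ w r i, |B.weights w r i| ≤ W) (hε : 0 < ε) :
    ∃ (l : ℕ) (n : ℕ → ℕ), 0 < l ∧ (∀ k, 0 < n k) ∧
      (∀ k, M * stageStart (fun k => 2 * n k) k ≤ n k) ∧
      (∀ s' : B.Strategy (zigzag p q fun _ => l), ∃ s : B.Strategy (zigzag p q n),
        ∀ r : B.Outcome _ s, ∃ r' : B.Outcome _ s', ∀ k,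
          |stageSum (B.weights (zigzag p q n) r.1) (fun k => 2 * n k) k / (2 * n k : ℕ) -
            stageSum (B.weights (zigzag p q fun _ => l) r'.1) (fun _ => 2 * l) k / (2 * l : ℕ)|
              ≤ ε) ∧
      (∀ s' : B.Strategy (zigzag p q n), ∃ s : B.Strategy (zigzag p q fun _ => l),
        ∀ r : B.Outcome _ s, ∃ r' : B.Outcome _ s', ∀ k,
          |stageSum (B.weights (zigzag p q fun _ => l) r.1) (fun _ => 2 * l) k / (2 * l : ℕ) -
            stageSum (B.weights (zigzag p q n) r'.1) (fun k => 2 * n k) k / (2 * n k : ℕ)|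
              ≤ ε) := by
  have := B.finite
  obtain ⟨C, _, c, hc⟩ := exists_finite_cells W hε
  let T : ℕ → Set (B.State × Set (B.State × C)) := fun n =>
    {x | B.Forces (fun i => if i < n then p else q) 0 (2 * n) x.1
      {y | (y.1, c (y.2 / (2 * n : ℕ))) ∈ x.2}}
  obtain ⟨τ, hτ⟩ := Finite.exists_infinite_fiber T
  have hinf : (T ⁻¹' {τ}).Infinite := Set.infinite_coe_iff.1 hτ
  obtain ⟨l, hl, hl0⟩ := hinf.exists_gt 0
  obtain ⟨n, hn⟩ := exists_fast_sequence hinf M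
  have hn0 : ∀ k, 0 < n k := fun k => (hn k).2.1
  have key : ∀ n : ℕ → ℕ, (∀ k, 0 < n k) → (∀ k, T (n k) = τ) → ∀ k q₀ U,
      B.Forces (zigzag p q n) (stageStart (fun k => 2 * n k) k) (2 * n k) q₀
        {y | (y.1, c (y.2 / (2 * n k : ℕ))) ∈ U} ↔ (q₀, U) ∈ τ := by
    intro n hn hτ k q₀ U
    rw [← hτ k]
    exact forces_congr fun i hi => by rw [zigzag_apply p q hn hi, zero_add]
  have key₁ := key n hn0 fun k => (hn k).1
  have key₂ := key (fun _ => l) (fun _ => hl0) fun _ => hl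
  have h1 : ∀ k, 0 < 2 * n k := fun k => by have := hn0 k; omega
  have h2 : ∀ _ : ℕ, 0 < 2 * l := fun _ => by omega
  refine ⟨l, n, hl0, hn0, fun k => (hn k).2.2, fun s' => ?_, fun s' => ?_⟩
  · obtain ⟨s, hs⟩ := exists_simulation c h1 h2
      (fun k q₀ U h => (key₁ k q₀ U).2 ((key₂ k q₀ U).1 h)) s'
    refine ⟨s, fun r => ?_⟩
    obtain ⟨r', hr'⟩ := hs r
    exact ⟨r', fun k => hc _ _ (abs_stageSum_div_le (hW _ _) h1 k)
      (abs_stageSum_div_le (hW _ _) h2 k) (hr' k)⟩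
  · obtain ⟨s, hs⟩ := exists_simulation c h2 h1
      (fun k q₀ U h => (key₂ k q₀ U).2 ((key₁ k q₀ U).1 h)) s'
    refine ⟨s, fun r => ?_⟩
    obtain ⟨r', hr'⟩ := hs r
    exact ⟨r', fun k => hc _ _ (abs_stageSum_div_le (hW _ _) h2 k)
      (abs_stageSum_div_le (hW _ _) h1 k) (hr' k)⟩

theorem lang_ne_signLang (B : AltAutomaton Letter) (m : Mode) : B.lang m ≠ signLang := by
  intro hB
  obtain ⟨W, hW⟩ := B.exists_abs_weights_le
  obtain ⟨M, hM⟩ := exists_nat_gt (20 * |W| + 1)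
  have hM1 : 1 ≤ M := by
    have : (0 : ℝ) < M := by linarith [abs_nonneg W]
    exact_mod_cast this
  have fast : ∀ {n : ℕ → ℕ}, (∀ k, M * stageStart (fun k => 2 * n k) k ≤ n k) →
      ∀ k, stageStart (fun k => 2 * n k) k ≤ n k := fun h k =>
    (Nat.le_mul_of_pos_left _ hM1).trans (h k)
  have close : ∀ {n : ℕ → ℕ}, (∀ k, 0 < n k) →
      (∀ k, M * stageStart (fun k => 2 * n k) k ≤ n k) → ∀ w r k,
      |avg (B.weights w r) (stageStart (fun k => 2 * n k) (k + 1)) -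
        stageSum (B.weights w r) (fun k => 2 * n k) k / (2 * n k : ℕ)| ≤ 1 / 10 := by
    intro n hn hf w r k
    refine abs_avg_sub_stageSum_le (hW w r) (n := fun k => 2 * n k)
      (fun k => by have := hn k; omega) ?_ (by norm_num)
    have h1 : (M : ℝ) * stageStart (fun k => 2 * n k) k ≤ n k := by exact_mod_cast hf k
    have h2 : 20 * W ≤ M := by linarith [le_abs_self W]
    have h3 := mul_le_mul_of_nonneg_right h2
      (Nat.cast_nonneg (α := ℝ) (stageStart (fun k => 2 * n k) k))
    have h4 : (0 : ℝ) ≤ n k := Nat.cast_nonneg _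
    push_cast
    linarith
  have tends : ∀ {n : ℕ → ℕ}, (∀ k, 0 < n k) →
      Tendsto (fun k => stageStart (fun k => 2 * n k) (k + 1)) atTop atTop := fun hn =>
    (tendsto_atTop_mono (le_stageStart fun k => by have := hn k; omega) tendsto_id).comp
      (tendsto_add_atTop_nat 1)
  cases m with
  | limSupAvg =>
    obtain ⟨l, n, hl, hn, hf, htr, -⟩ :=
      B.exists_transfer .b .a M hW (ε := 1 / 10) (by norm_num)
    have hper := signLang_zigzag_const (p := .b) (q := .a) (by simp [Letter.sign]) hl
    have hfast := signLang_zigzag_le_neg_half hn (fast hf)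
    rw [← hB] at hper hfast
    obtain ⟨s', hs'⟩ := exists_strategy_of_lt_lang
      (show -(1 / 10) < B.lang .limSupAvg (zigzag .b .a fun _ => l) by rw [hper]; norm_num)
    obtain ⟨s, hs⟩ := htr s'
    refine absurd (hfast.trans_lt (show -(1 / 2 : ℝ) < -(3 / 10) by norm_num)) (not_lt.2 ?_)
    refine le_lang s fun r => ?_
    obtain ⟨r', hr'⟩ := hs r
    have hfreq : ∃ᶠ k in atTop, -(1 / 10) ≤ stageSum (B.weights (zigzag .b .a fun _ => l) r'.1)
        (fun _ => 2 * l) k / (2 * l : ℕ) := by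
      intro h
      refine (hs' r').not_ge (Mode.val_le_of_stageSum _ (hW _ _) (l := 2 * l) (by omega) ?_)
      exact h.mono fun k hk => (not_le.1 hk).le
    refine le_limsup_of_frequently_le ((tends hn).frequently (hfreq.mono fun k hk => ?_))
      (isBoundedUnder_le_avg (hW _ _))
    have h1 := (abs_le.1 (hr' k)).1
    have h2 := (abs_le.1 (close hn hf (zigzag .b .a n) r.1 k)).1
    linarith
  | limInfAvg =>
    obtain ⟨l, n, hl, hn, hf, -, htr⟩ :=
      B.exists_transfer .a .b M hW (ε := 1 / 10) (by norm_num)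
    have hper := signLang_zigzag_const (p := .a) (q := .b) (by simp [Letter.sign]) hl
    have hfast := half_le_signLang_zigzag hn (fast hf)
    rw [← hB] at hper hfast
    obtain ⟨s', hs'⟩ := exists_strategy_of_lt_lang
      (show 4 / 10 < B.lang .limInfAvg (zigzag .a .b n) by linarith)
    obtain ⟨s, hs⟩ := htr s'
    refine absurd hper (ne_of_gt ((show (0 : ℝ) < 1 / 10 by norm_num).trans_le ?_))
    refine le_lang s fun r => ?_
    obtain ⟨r', hr'⟩ := hs r
    have hev := (tends hn).eventually
      (eventually_lt_of_lt_liminf (hs' r') (isBoundedUnder_ge_avg (hW _ _)))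
    refine Mode.le_val_of_stageSum _ (hW _ _) (l := 2 * l) (by omega) (hev.mono fun k hk => ?_)
    have h1 := (abs_le.1 (hr' k)).1
    have h2 := (abs_le.1 (close hn hf (zigzag .a .b n) r'.1 k)).2
    linarith

end AltAutomaton

namespace WeightedAutomaton

variable {α : Type}

theorem exists_abs_weights_le [Finite α] (A : WeightedAutomaton α) :
    ∃ W, ∀ w r i, |A.weights w r i| ≤ W := by
  have := A.finite
  obtain ⟨W, hW⟩ := exists_forall_abs_le fun x : A.State × α × A.State => (A.wt x.1 x.2.1 x.2.2 : ℝ)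
  exact ⟨W, fun w r i => hW (r i, w i, r (i + 1))⟩

theorem bddAbove_values [Finite α] (A : WeightedAutomaton α) (m : Mode) (w : ℕ → α) :
    BddAbove {x | ∃ r, A.IsRun w r ∧ x = m.val (A.weights w r)} := by
  obtain ⟨W, hW⟩ := A.exists_abs_weights_le
  refine ⟨W, ?_⟩
  rintro _ ⟨r, -, rfl⟩
  exact (abs_le.1 (m.abs_val_le (hW w r))).2

theorem exists_run (A : WeightedAutomaton α) (w : ℕ → α) : ∃ r, A.IsRun w r := by
  choose δ hδ using A.total
  exact ⟨fun i => Nat.rec A.init (fun i q => δ q (w i)) i, rfl, fun i => hδ _ _⟩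

theorem exists_posBool (A : WeightedAutomaton α) (q : A.State) (l : α) :
    ∃ φ : PosBool A.State, ∀ S, φ.Sat S ↔ ∃ q' ∈ S, A.trans q l q' := by
  have := A.finite
  obtain ⟨T, hT⟩ := (Set.toFinite {q' | A.trans q l q'}).exists_finset
  have hne : T.Nonempty := by
    obtain ⟨q', hq'⟩ := A.total q l
    exact ⟨q', (hT q').2 hq'⟩
  have : ∃ φ : PosBool A.State, ∀ S, φ.Sat S ↔ ∃ q' ∈ S, q' ∈ T := by
    clear hT
    induction hne using Finset.Nonempty.cons_induction with
    | singleton a => exact ⟨.atom a, fun S => by simp [PosBool.Sat]⟩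
    | cons a T h hne ih =>
      obtain ⟨φ, hφ⟩ := ih
      refine ⟨.disj (.atom a) φ, fun S => ?_⟩
      simp only [PosBool.Sat, hφ, Finset.mem_cons]
      constructor
      · rintro (ha | ⟨q', hq, hT⟩)
        · exact ⟨a, ha, Or.inl rfl⟩
        · exact ⟨q', hq, Or.inr hT⟩
      · rintro ⟨q', hq, rfl | hT⟩
        · exact Or.inl hq
        · exact Or.inr ⟨q', hq, hT⟩
  obtain ⟨φ, hφ⟩ := this
  exact ⟨φ, fun S => by simp only [hφ, hT, Set.mem_ofPred_eq]⟩

/-- Each nondeterministic automaton is equivalent to an alternating one. -/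
theorem exists_altAutomaton [Finite α] (A : WeightedAutomaton α) :
    ∃ B : AltAutomaton α, ∀ m, B.lang m = A.lang m := by
  choose φ hφ using A.exists_posBool
  let B : AltAutomaton α := ⟨A.State, A.finite, A.init, φ, A.wt⟩
  refine ⟨B, fun m => funext fun w => le_antisymm ?_ ?_⟩
  · refine ciSup_le fun s => ?_
    obtain ⟨r, hr⟩ := AltAutomaton.exists_outcome s (fun i q q' => A.trans q (w i) q')
      fun h q => (hφ q (w h.length) _).1 (s.2 h q)
    exact (ciInf_le (AltAutomaton.bddBelow_range_val m s) r).trans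
      (le_csSup (A.bddAbove_values m w) ⟨r.1, ⟨r.2.1, hr⟩, rfl⟩)
  · obtain ⟨r₀, hr₀⟩ := A.exists_run w
    refine csSup_le ⟨_, r₀, hr₀, rfl⟩ ?_
    rintro _ ⟨r, hr, rfl⟩
    classical
    let s : B.Strategy w := ⟨fun h q => if q = r h.length then {r (h.length + 1)} else Set.univ, by
      intro h q
      beta_reduce
      split_ifs with hq
      · exact (hφ _ _ _).2 ⟨_, rfl, by rw [hq]; exact hr.2 _⟩
      · exact PosBool.sat_univ _⟩
    refine AltAutomaton.le_lang s fun r' => ?_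
    have : ∀ i, r'.1 i = r i := by
      intro i
      induction i with
      | zero => exact r'.2.1.trans hr.1.symm
      | succ i ih =>
        have := r'.2.2 i
        simp only [s, List.length_ofFn, ih, if_true] at this
        exact this
    rw [funext this]
    exact le_rfl

end WeightedAutomaton

theorem Mode.val_eq_of_tendsto (m : Mode) {v : ℕ → ℝ} {c : ℝ} (h : Tendsto v atTop (nhds c)) :
    m.val v = c := by
  have h' : Tendsto (avg v) atTop (nhds c) := h.cesaro.congr fun n => by rw [avg, one_div]
  cases m with
  | limInfAvg => exact h'.liminf_eq
  | limSupAvg => exact h'.limsup_eq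

section FinitelyManyA

/-- The automaton that guesses a position after which only the letter `b` occurs. It waits in
`none`, verifies the guess in `some true`, and is stuck in `some false` when the guess fails. -/
def guessAutomaton : WeightedAutomaton Letter where
  State := Option Bool
  finite := inferInstance
  init := none
  trans q l q' := match q with
    | none => q' ≠ some false
    | some true => (l = .b → q' = some true) ∧ (l = .a → q' = some false)
    | some false => q' = some false
  total q l := by
    rcases q with _ | _ | _
    · exact ⟨none, by simp⟩
    · exact ⟨some false, rfl⟩
    · cases l
      · exact ⟨some false, by simp⟩
      · exact ⟨some true, by simp⟩
  wt q _ q' := if q = some true ∧ q' = some true then 1 else 0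

theorem guessAutomaton_exists_run {w : ℕ → Letter} (h : {i | w i = .a}.Finite) (m : Mode) :
    ∃ r, guessAutomaton.IsRun w r ∧ m.val (guessAutomaton.weights w r) = 1 := by
  obtain ⟨k, hk⟩ := h.bddAbove
  refine ⟨fun i => if i ≤ k then none else some true, ⟨by simp [guessAutomaton], fun i => ?_⟩, ?_⟩
  · change match (if i ≤ k then none else some true : Option Bool) with
      | none => (if i + 1 ≤ k then none else some true : Option Bool) ≠ some false
      | some true => (w i = .b → (if i + 1 ≤ k then none else some true : Option Bool) = some true) ∧
          (w i = .a → (if i + 1 ≤ k then none else some true : Option Bool) = some false)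
      | some false => (if i + 1 ≤ k then none else some true : Option Bool) = some false
    rcases le_or_gt i k with hi | hi
    · rw [if_pos hi]
      dsimp only
      split_ifs <;> simp
    · rw [if_neg (by omega), if_neg (by omega)]
      exact ⟨fun _ => rfl, fun ha => absurd (hk ha) (by omega)⟩
  · refine m.val_eq_of_tendsto (tendsto_const_nhds.congr' ?_)
    filter_upwards [eventually_gt_atTop k] with i hi
    have h1 : ¬ i ≤ k := by omega
    have h2 : ¬ i + 1 ≤ k := by omega
    simp [WeightedAutomaton.weights, guessAutomaton, h1, h2]

theorem guessAutomaton_val_of_infinite {w : ℕ → Letter} (h : ¬ {i | w i = .a}.Finite) (m : Mode)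
    {r : ℕ → guessAutomaton.State} (hr : guessAutomaton.IsRun w r) :
    m.val (guessAutomaton.weights w r) = 0 := by
  have hev : ∃ k, ∀ i ≥ k, r i ≠ some true := by
    by_cases hf : ∃ k, r k = some false
    · obtain ⟨k, hk⟩ := hf
      have : ∀ i ≥ k, r i = some false := by
        intro i hi
        induction i, hi using Nat.le_induction with
        | base => exact hk
        | succ i hi ih =>
          have := hr.2 i
          rw [ih] at this
          exact this
      exact ⟨k, fun i hi h => by cases (this i hi).symm.trans h⟩
    · refine ⟨0, fun k _ hk => hf ?_⟩
      push Not at hf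
      have htrue : ∀ i ≥ k, r i = some true := by
        intro i hi
        induction i, hi using Nat.le_induction with
        | base => exact hk
        | succ i hi ih =>
          have := hr.2 i
          rw [ih] at this
          cases hw : w i with
          | a => exact absurd (this.2 hw) (hf _)
          | b => exact this.1 hw
      obtain ⟨i, hi, hki⟩ := Set.Infinite.exists_gt h k
      have := hr.2 i
      rw [htrue i hki.le] at this
      exact ⟨_, this.2 hi⟩
  obtain ⟨k, hk⟩ := hev
  refine m.val_eq_of_tendsto (tendsto_const_nhds.congr' ?_)
  filter_upwards [eventually_ge_atTop k] with i hi
  simp only [WeightedAutomaton.weights, guessAutomaton]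
  rw [if_neg fun h => hk i hi h.1, Rat.cast_zero]

theorem guessAutomaton_lang (m : Mode) : guessAutomaton.lang m = finitelyManyA := by
  funext w
  rw [WeightedAutomaton.lang, finitelyManyA]
  split_ifs with h
  · obtain ⟨r, hr, hval⟩ := guessAutomaton_exists_run h m
    refine le_antisymm (csSup_le ⟨_, r, hr, rfl⟩ ?_)
      (le_csSup (guessAutomaton.bddAbove_values m w) ⟨r, hr, hval.symm⟩)
    rintro _ ⟨r, -, rfl⟩
    refine (abs_le.1 (m.abs_val_le (W := 1) fun i => ?_)).2
    simp only [WeightedAutomaton.weights, guessAutomaton]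
    split_ifs <;> simp
  · obtain ⟨r, hr⟩ := guessAutomaton.exists_run w
    have : {x | ∃ r, guessAutomaton.IsRun w r ∧ x = m.val (guessAutomaton.weights w r)} = {0} := by
      ext x
      constructor
      · rintro ⟨r, hr, rfl⟩
        exact guessAutomaton_val_of_infinite h m hr
      · rintro rfl
        exact ⟨r, hr, (guessAutomaton_val_of_infinite h m hr).symm⟩
    rw [this, csSup_singleton]

end FinitelyManyA

section Idempotent

/-- The `N`-th iterate of each self-map of `Q` is idempotent. -/
def IdempotentIterates (Q : Type) (N : ℕ) : Prop :=
  ∀ (f : Q → Q) (x : Q), f^[N] (f^[N] x) = f^[N] x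

theorem exists_idempotentIterates (Q : Type) [Finite Q] : ∃ N, 0 < N ∧ IdempotentIterates Q N := by
  obtain ⟨i, j, hij, h⟩ := Finite.exists_ne_map_eq_of_infinite
    fun (n : ℕ) (f : Q → Q) => f^[n]
  wlog hlt : i < j generalizing i j
  · exact this j i hij.symm h.symm (by omega)
  obtain ⟨p, rfl⟩ : ∃ p, j = i + p := ⟨j - i, by omega⟩
  have hp : 0 < p := by omega
  have h1 : ∀ (f : Q → Q) n, i ≤ n → f^[n + p] = f^[n] := by
    intro f n hn
    obtain ⟨d, rfl⟩ := Nat.exists_eq_add_of_le' hn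
    rw [add_assoc, Function.iterate_add, Function.iterate_add f d i]
    exact congrArg _ (congrFun h f).symm
  have h2 : ∀ (f : Q → Q) n k, i ≤ n → f^[n + k * p] = f^[n] := by
    intro f n k hn
    induction k with
    | zero => simp
    | succ k ih => rw [add_mul, one_mul, ← add_assoc, h1 f _ (by omega), ih]
  refine ⟨(i + 1) * p, by positivity, fun f x => ?_⟩
  rw [← Function.iterate_add_apply, h2 f]
  nlinarith

theorem IdempotentIterates.mul {Q : Type} {N k : ℕ} (h : IdempotentIterates Q N) (hk : 0 < k) :
    IdempotentIterates Q (N * k) := by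
  intro f x
  have : ∀ y, f^[N * k] y = f^[N] y := by
    intro y
    rw [Function.iterate_mul]
    induction k, hk using Nat.le_induction with
    | base => rfl
    | succ k hk ih => rw [Function.iterate_succ_apply', ih, h f y]
  rw [this, this, h f x]

end Idempotent

theorem Mode.val_eq_of_stages (m : Mode) {v : ℕ → ℝ} {W μ D : ℝ} (hv : ∀ i, |v i| ≤ W)
    {n : ℕ → ℕ} (hn : ∀ k, 0 < n k) (hn' : ∀ k, k ≤ n k)
    (h : ∀ k, ∀ i ≤ n k, |∑ j ∈ Finset.range i, (v (stageStart n k + j) - μ)| ≤ D) :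
    m.val v = μ := by
  have hD : 0 ≤ D := (abs_nonneg _).trans (h 0 0 (by omega))
  have h1 : ∀ k, |∑ j ∈ Finset.range (stageStart n k), (v j - μ)| ≤ k * D := by
    intro k
    induction k with
    | zero => simp [stageStart_zero]
    | succ k ih =>
      rw [stageStart_succ, Finset.sum_range_add]
      refine (abs_add_le _ _).trans ((add_le_add ih (h k _ le_rfl)).trans_eq ?_)
      push_cast
      ring
  have h2 : ∀ ε > 0, ∃ C, ∀ k : ℕ, (k + 1) * D ≤ ε * stageStart n k + C := by
    intro ε hε
    obtain ⟨k₀, hk₀⟩ := exists_nat_gt (D / ε)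
    rw [div_lt_iff₀ hε] at hk₀
    refine ⟨(k₀ + 1) * D, fun k => ?_⟩
    induction k with
    | zero =>
      have : 0 ≤ (k₀ : ℝ) * D := by positivity
      simp only [stageStart_zero, Nat.cast_zero]
      linarith
    | succ k ih =>
      rcases lt_or_ge k k₀ with hk | hk
      · have h3 : ((k + 1 : ℕ) : ℝ) ≤ k₀ := by exact_mod_cast hk
        have h4 : 0 ≤ ε * stageStart n (k + 1) := by positivity
        nlinarith
      · have h3 : (k₀ : ℝ) ≤ n k := by exact_mod_cast hk.trans (hn' k)
        rw [stageStart_succ]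
        push_cast
        nlinarith
  have h3 : ∀ ε > 0, ∃ C, ∀ l : ℕ,
      |∑ j ∈ Finset.range l, v j - μ * l| ≤ ε * l + C := by
    intro ε hε
    obtain ⟨C, hC⟩ := h2 ε hε
    refine ⟨C, fun l => ?_⟩
    obtain ⟨k, i, hi, rfl⟩ := exists_stage hn l
    have e : ∑ j ∈ Finset.range (stageStart n k + i), v j - μ * (stageStart n k + i : ℕ) =
        ∑ j ∈ Finset.range (stageStart n k + i), (v j - μ) := by
      rw [Finset.sum_sub_distrib, Finset.sum_const, Finset.card_range, nsmul_eq_mul, mul_comm μ]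
    rw [e, Finset.sum_range_add]
    have h4 := (abs_add_le _ _).trans (add_le_add (h1 k) (h k i hi.le))
    have h5 : (0 : ℝ) ≤ ε * i := by positivity
    have h6 := hC k
    push_cast
    linarith
  refine le_antisymm (le_of_forall_pos_le_add fun ε hε => ?_)
    (le_of_forall_sub_le fun ε hε => ?_)
  · obtain ⟨C, hC⟩ := h3 ε hε
    refine m.val_le_of_sum_le (C := C) hv (.of_forall fun l => ?_)
    linarith [(abs_le.1 (hC l)).2]
  · obtain ⟨C, hC⟩ := h3 ε hε
    refine m.le_val_of_le_sum (C := C) hv (.of_forall fun l => ?_)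
    linarith [(abs_le.1 (hC l)).1]

theorem abs_sum_le_of_periodic {φ : ℕ → ℝ} {W : ℝ} {N : ℕ} (hN : 0 < N) (hφ : ∀ i, |φ i| ≤ W)
    (hper : ∀ i, φ (i + N) = φ i) (hsum : ∑ i ∈ Finset.range N, φ i = 0) (l : ℕ) :
    |∑ i ∈ Finset.range l, φ i| ≤ N * W := by
  have hW : 0 ≤ W := (abs_nonneg _).trans (hφ 0)
  have h : Function.Periodic (fun l => ∑ i ∈ Finset.range l, φ i) N := by
    intro l
    simp only
    rw [add_comm l N, Finset.sum_range_add, hsum, zero_add]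
    exact Finset.sum_congr rfl fun i _ => by rw [add_comm N i, hper]
  have h1 : ∑ i ∈ Finset.range l, φ i = ∑ i ∈ Finset.range (l % N), φ i := (h.map_mod_nat l).symm
  have h2 := abs_sum_add_le hφ 0 (l % N)
  simp only [zero_add] at h2
  rw [h1]
  refine h2.trans ?_
  have : ((l % N : ℕ) : ℝ) ≤ N := by exact_mod_cast (Nat.mod_lt l hN).le
  gcongr

section PauseWord

/-- The length of the stage `j` of the words below. -/
def pauseLength (N j : ℕ) : ℕ := N * (N + 1) + j * N

theorem pauseLength_pos {N : ℕ} (hN : 0 < N) (j : ℕ) : 0 < pauseLength N j := by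
  unfold pauseLength; positivity

theorem le_pauseLength {N : ℕ} (hN : 0 < N) (j : ℕ) : j ≤ pauseLength N j := by
  unfold pauseLength; nlinarith

/-- The word whose stage `j` is `(a b ^ N) ^ N b ^ (j N)` if `j ∈ F`, and a power of `b` of the same
length otherwise. -/
noncomputable def pauseWord (N : ℕ) (F : Set ℕ) : ℕ → Letter :=
  open Classical in stageWord (pauseLength N) fun j i =>
    if j ∈ F ∧ i < N * (N + 1) ∧ i % (N + 1) = 0 then .a else .b

variable {N : ℕ} {F : Set ℕ}

theorem pauseWord_eq_a_iff (hN : 0 < N) {j i : ℕ} (hi : i < pauseLength N j) :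
    pauseWord N F (stageStart (pauseLength N) j + i) = .a ↔
      j ∈ F ∧ i < N * (N + 1) ∧ i % (N + 1) = 0 := by
  rw [pauseWord, stageWord_apply (pauseLength_pos hN) _ hi]
  split_ifs with h <;> simp [h]

theorem Letter.ne_a_iff {l : Letter} : l ≠ .a ↔ l = .b := by
  cases l <;> simp

theorem pauseWord_univ_infinite (hN : 0 < N) : {i | pauseWord N Set.univ i = .a}.Infinite := by
  refine Set.infinite_of_forall_exists_gt fun k => ⟨stageStart (pauseLength N) (k + 1) + 0, ?_, ?_⟩
  · exact (pauseWord_eq_a_iff hN (pauseLength_pos hN _)).2 ⟨trivial, by positivity, by simp⟩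
  · exact Nat.lt_of_succ_le (le_stageStart (pauseLength_pos hN) (k + 1))

theorem pauseWord_zero_finite (hN : 0 < N) : {i | pauseWord N {0} i = .a}.Finite := by
  refine (Set.finite_Iio (stageStart (pauseLength N) 1)).subset fun i hi => ?_
  obtain ⟨k, i, hik, rfl⟩ := exists_stage (pauseLength_pos hN) i
  obtain ⟨rfl, -⟩ := (pauseWord_eq_a_iff hN hik).1 hi
  rw [Set.mem_Iio, stageStart_succ]
  omega

variable {Q : Type} {δ : Q → Letter → Q} {q₀ : Q}

/-- The state after reading the first `i` letters of a word, from the state `q₀` on. -/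
def stateAfter (δ : Q → Letter → Q) (q₀ : Q) (w : ℕ → Letter) : ℕ → Q
  | 0 => q₀
  | i + 1 => δ (stateAfter δ q₀ w i) (w i)

theorem stateAfter_add {w : ℕ → Letter} {t n : ℕ} (h : ∀ i < n, w (t + i) = .b) :
    stateAfter δ q₀ w (t + n) = (δ · .b)^[n] (stateAfter δ q₀ w t) := by
  induction n with
  | zero => rfl
  | succ n ih =>
    rw [← add_assoc, stateAfter, ih fun i hi => h i (by omega), h n (by omega),
      Function.iterate_succ_apply']

/-- The effect of the word `a b ^ N` on the states. -/
def pauseStep (δ : Q → Letter → Q) (N : ℕ) (q : Q) : Q := (δ · .b)^[N] (δ q .a)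

theorem stateAfter_pauseWord_of_mem (hN : 0 < N) {j : ℕ} (hj : j ∈ F) {i : ℕ} (hi : i ≤ N) :
    stateAfter δ q₀ (pauseWord N F) (stageStart (pauseLength N) j + i * (N + 1)) =
      (pauseStep δ N)^[i] (stateAfter δ q₀ (pauseWord N F) (stageStart (pauseLength N) j)) := by
  induction i with
  | zero => simp
  | succ i ih =>
    have hlt : i * (N + 1) + (N + 1) ≤ N * (N + 1) := by nlinarith
    have hle : N * (N + 1) ≤ pauseLength N j := Nat.le_add_right _ _
    have ha : pauseWord N F (stageStart (pauseLength N) j + i * (N + 1)) = .a :=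
      (pauseWord_eq_a_iff hN (by omega)).2 ⟨hj, by omega, Nat.mul_mod_left _ _⟩
    have e : stageStart (pauseLength N) j + (i + 1) * (N + 1) =
        stageStart (pauseLength N) j + i * (N + 1) + 1 + N := by ring
    rw [e, stateAfter_add, stateAfter, ha, ih (by omega), Function.iterate_succ_apply', pauseStep]
    intro d hd
    rw [← Letter.ne_a_iff, add_assoc, add_assoc, ne_eq, pauseWord_eq_a_iff hN (by omega)]
    rintro ⟨-, -, h⟩
    rw [Nat.mul_add_mod_self_right, Nat.mod_eq_of_lt (by omega)] at h
    omega

theorem stateAfter_pauseWord (hN : 0 < N) (hQ : IdempotentIterates Q N) (hF : 0 ∈ F) (j : ℕ) :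
    stateAfter δ q₀ (pauseWord N F) (stageStart (pauseLength N) j + N * (N + 1)) =
      (pauseStep δ N)^[N] q₀ := by
  have hfix : (δ · .b)^[N] ((pauseStep δ N)^[N] q₀) = (pauseStep δ N)^[N] q₀ := by
    obtain ⟨M, rfl⟩ := Nat.exists_eq_add_of_le' hN
    rw [Function.iterate_succ_apply' (pauseStep δ _)]
    exact hQ _ _
  have hfix' : ∀ k, (δ · .b)^[N * k] ((pauseStep δ N)^[N] q₀) = (pauseStep δ N)^[N] q₀ := by
    intro k
    rw [Function.iterate_mul]
    exact Function.iterate_fixed hfix k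
  induction j with
  | zero => rw [stateAfter_pauseWord_of_mem hN hF le_rfl]; rfl
  | succ j ih =>
    have hstart : stateAfter δ q₀ (pauseWord N F) (stageStart (pauseLength N) (j + 1)) =
        (pauseStep δ N)^[N] q₀ := by
      have e : stageStart (pauseLength N) (j + 1) =
          stageStart (pauseLength N) j + N * (N + 1) + N * j := by
        rw [stageStart_succ, pauseLength]; ring
      rw [e, stateAfter_add, ih, hfix']
      intro i hi
      rw [← Letter.ne_a_iff, add_assoc, ne_eq, pauseWord_eq_a_iff hN]
      · rintro ⟨-, h, -⟩
        omega
      · rw [pauseLength, mul_comm j]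
        omega
    by_cases hj : j + 1 ∈ F
    · rw [stateAfter_pauseWord_of_mem hN hj le_rfl, hstart, hQ]
    · rw [stateAfter_add, hstart, hfix']
      intro i hi
      rw [← Letter.ne_a_iff, ne_eq, pauseWord_eq_a_iff hN]
      · exact fun h => hj h.1
      · rw [pauseLength]
        omega

theorem Mode.exists_val_pauseWord (m : Mode) (hN : 0 < N) (hQ : IdempotentIterates Q N)
    (δ : Q → Letter → Q) (q₀ : Q) {f : Q → Letter → ℝ} {W : ℝ} (hf : ∀ q l, |f q l| ≤ W) :
    ∃ μ, ∀ F : Set ℕ, 0 ∈ F →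
      m.val (fun i => f (stateAfter δ q₀ (pauseWord N F) i) (pauseWord N F i)) = μ := by
  obtain ⟨q, hq⟩ : ∃ q, q = (pauseStep δ N)^[N] q₀ := ⟨_, rfl⟩
  have hfix : (δ · .b)^[N] q = q := by
    rw [hq]
    obtain ⟨M, rfl⟩ := Nat.exists_eq_add_of_le' hN
    rw [Function.iterate_succ_apply' (pauseStep δ _)]
    exact hQ _ _
  have hN' : (0 : ℝ) < N := by exact_mod_cast hN
  let ω : ℕ → ℝ := fun i => f ((δ · .b)^[i] q) .b
  let μ : ℝ := (∑ i ∈ Finset.range N, ω i) / N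
  have hμ : |μ| ≤ W := by
    have := abs_sum_add_le (v := ω) (W := W) (fun _ => hf _ _) 0 N
    simp only [zero_add] at this
    rw [abs_div, abs_of_pos hN', div_le_iff₀ hN', mul_comm]
    exact this
  have hsub : ∀ x, |x| ≤ W → |x - μ| ≤ 2 * W := fun x hx => (abs_sub _ _).trans (by linarith)
  have hW : 0 ≤ W := (abs_nonneg _).trans hμ
  have hcycle : ∀ l, |∑ i ∈ Finset.range l, (ω i - μ)| ≤ N * (2 * W) := by
    refine abs_sum_le_of_periodic hN (fun i => hsub _ (hf _ _)) (fun i => ?_) ?_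
    · simp only [ω]
      rw [Function.iterate_add_apply, hfix]
    · rw [Finset.sum_sub_distrib, Finset.sum_const, Finset.card_range, nsmul_eq_mul,
        mul_div_cancel₀ _ hN'.ne', sub_self]
  refine ⟨μ, fun F hF => m.val_eq_of_stages (D := (N * (N + 1) : ℕ) * (2 * W) + N * (2 * W))
    (fun i => hf _ _) (pauseLength_pos hN) (le_pauseLength hN) fun j i hi => ?_⟩
  have hpart : ∀ t d, |∑ i ∈ Finset.range d,
      (f (stateAfter δ q₀ (pauseWord N F) (t + i)) (pauseWord N F (t + i)) - μ)| ≤ d * (2 * W) :=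
    fun t d => abs_sum_add_le
      (v := fun i => f (stateAfter δ q₀ (pauseWord N F) i) (pauseWord N F i) - μ)
      (fun i => hsub _ (hf _ _)) t d
  rcases le_total i (N * (N + 1)) with h | h
  · refine (hpart _ i).trans ?_
    have h1 : (i : ℝ) ≤ (N * (N + 1) : ℕ) := by exact_mod_cast h
    have h2 : 0 ≤ N * (2 * W) := by positivity
    nlinarith
  · obtain ⟨d, rfl⟩ := Nat.exists_eq_add_of_le h
    rw [Finset.sum_range_add]
    refine (abs_add_le _ _).trans (add_le_add (hpart _ _) ?_)
    have hb : ∀ i < d, pauseWord N F (stageStart (pauseLength N) j + N * (N + 1) + i) = .b := by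
      intro i hid
      rw [← Letter.ne_a_iff, add_assoc, ne_eq, pauseWord_eq_a_iff hN (by omega)]
      rintro ⟨-, h, -⟩
      omega
    refine (hcycle d).trans' (le_of_eq (congrArg _ (Finset.sum_congr rfl fun i hi => ?_)))
    have hi := Finset.mem_range.1 hi
    rw [← add_assoc, hb i hi, stateAfter_add fun i' hi' => hb i' (hi'.trans hi),
      stateAfter_pauseWord hN hQ hF, ← hq]

theorem WeightedAutomaton.IsDeterministic.exists_lang_eq {A : WeightedAutomaton Letter}
    (hA : A.IsDeterministic) : ∃ δ : A.State → Letter → A.State, ∀ m w, A.lang m w =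
      m.val fun i => (A.wt (stateAfter δ A.init w i) (w i) (δ (stateAfter δ A.init w i) (w i)) : ℝ) := by
  choose δ hδ huniq using hA
  refine ⟨δ, fun m w => ?_⟩
  have : {x | ∃ r, A.IsRun w r ∧ x = m.val (A.weights w r)} =
      {m.val (A.weights w (stateAfter δ A.init w))} := by
    ext x
    constructor
    · rintro ⟨r, hr, rfl⟩
      have : r = stateAfter δ A.init w := by
        funext i
        induction i with
        | zero => exact hr.1
        | succ i ih => rw [stateAfter, ← ih]; exact huniq _ _ _ (hr.2 i)
      rw [this]
      rfl
    · rintro rfl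
      exact ⟨_, ⟨rfl, fun i => hδ _ _⟩, rfl⟩
  rw [WeightedAutomaton.lang, this, csSup_singleton]
  rfl

theorem Expression.exists_lang_pauseWord_eq (E : Expression Letter) :
    ∃ N, 0 < N ∧ ∀ k, 0 < k → ∀ F G : Set ℕ, 0 ∈ F → 0 ∈ G →
      E.lang (pauseWord (N * k) F) = E.lang (pauseWord (N * k) G) := by
  have combine : ∀ E₁ E₂ : Expression Letter,
      (∃ N, 0 < N ∧ ∀ k, 0 < k → ∀ F G : Set ℕ, 0 ∈ F → 0 ∈ G →
        E₁.lang (pauseWord (N * k) F) = E₁.lang (pauseWord (N * k) G)) →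
      (∃ N, 0 < N ∧ ∀ k, 0 < k → ∀ F G : Set ℕ, 0 ∈ F → 0 ∈ G →
        E₂.lang (pauseWord (N * k) F) = E₂.lang (pauseWord (N * k) G)) →
      ∃ N, 0 < N ∧ ∀ k, 0 < k → ∀ F G : Set ℕ, 0 ∈ F → 0 ∈ G →
        E₁.lang (pauseWord (N * k) F) = E₁.lang (pauseWord (N * k) G) ∧
        E₂.lang (pauseWord (N * k) F) = E₂.lang (pauseWord (N * k) G) := by
    rintro E₁ E₂ ⟨N₁, hN₁, h₁⟩ ⟨N₂, hN₂, h₂⟩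
    refine ⟨N₁ * N₂, by positivity, fun k hk F G hF hG => ⟨?_, ?_⟩⟩
    · rw [mul_assoc]
      exact h₁ _ (by positivity) F G hF hG
    · rw [mul_comm N₁, mul_assoc]
      exact h₂ _ (by positivity) F G hF hG
  induction E with
  | aut m A hA =>
    have := A.finite
    obtain ⟨N, hN, hQ⟩ := exists_idempotentIterates A.State
    obtain ⟨δ, hδ⟩ := hA.exists_lang_eq
    obtain ⟨W, hW⟩ := exists_forall_abs_le fun x : A.State × Letter =>
      (A.wt x.1 x.2 (δ x.1 x.2) : ℝ)
    refine ⟨N, hN, fun k hk F G hF hG => ?_⟩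
    obtain ⟨μ, hμ⟩ := m.exists_val_pauseWord (by positivity : 0 < N * k) (hQ.mul hk) δ A.init
      (f := fun q l => (A.wt q l (δ q l) : ℝ)) fun q l => hW (q, l)
    simp only [Expression.lang, hδ]
    rw [hμ F hF, hμ G hG]
  | maxOf E₁ E₂ h₁ h₂ =>
    obtain ⟨N, hN, h⟩ := combine E₁ E₂ h₁ h₂
    refine ⟨N, hN, fun k hk F G hF hG => ?_⟩
    simp only [Expression.lang, h k hk F G hF hG]
  | minOf E₁ E₂ h₁ h₂ =>
    obtain ⟨N, hN, h⟩ := combine E₁ E₂ h₁ h₂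
    refine ⟨N, hN, fun k hk F G hF hG => ?_⟩
    simp only [Expression.lang, h k hk F G hF hG]
  | sumOf E₁ E₂ h₁ h₂ =>
    obtain ⟨N, hN, h⟩ := combine E₁ E₂ h₁ h₂
    refine ⟨N, hN, fun k hk F G hF hG => ?_⟩
    simp only [Expression.lang, h k hk F G hF hG]

theorem Expression.lang_ne_finitelyManyA (E : Expression Letter) : E.lang ≠ finitelyManyA := by
  intro hE
  obtain ⟨N, hN, h⟩ := E.exists_lang_pauseWord_eq
  have h' := h 1 one_pos Set.univ {0} trivial rfl
  rw [mul_one, hE, finitelyManyA, finitelyManyA, if_neg (pauseWord_univ_infinite hN),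
    if_pos (pauseWord_zero_finite hN)] at h'
  exact zero_ne_one h'

end PauseWord

end MeanPayoff

theorem mainTheorem3 :
    (∃ (α : Type) (_ : Finite α) (m₁ m₂ : MeanPayoff.Mode)
      (A₁ A₂ : MeanPayoff.WeightedAutomaton α)
      (h₁ : A₁.IsDeterministic) (h₂ : A₂.IsDeterministic) (L : MeanPayoff.QuantLang α),
      L = (MeanPayoff.Expression.sumOf (.aut m₁ A₁ h₁) (.aut m₂ A₂ h₂)).lang ∧
      (¬ ∃ (m : MeanPayoff.Mode) (B : MeanPayoff.AltAutomaton α), B.lang m = L) ∧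
      (¬ ∃ (m : MeanPayoff.Mode) (A : MeanPayoff.WeightedAutomaton α), A.lang m = L)) ∧
    ((∀ m : MeanPayoff.Mode, ∃ A : MeanPayoff.WeightedAutomaton MeanPayoff.Letter,
        A.lang m = MeanPayoff.finitelyManyA) ∧
      (∀ m : MeanPayoff.Mode, ∃ B : MeanPayoff.AltAutomaton MeanPayoff.Letter,
        B.lang m = MeanPayoff.finitelyManyA) ∧
      ¬ ∃ E : MeanPayoff.Expression MeanPayoff.Letter,
        E.lang = MeanPayoff.finitelyManyA) := by
  refine ⟨⟨MeanPayoff.Letter, inferInstance, .limInfAvg, .limSupAvg, MeanPayoff.signAutomaton,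
    MeanPayoff.signAutomaton, MeanPayoff.signAutomaton_isDeterministic,
    MeanPayoff.signAutomaton_isDeterministic, MeanPayoff.signLang, ?_, ?_, ?_⟩, ?_, ?_, ?_⟩
  · funext w
    simp only [MeanPayoff.Expression.lang, MeanPayoff.signAutomaton_lang, MeanPayoff.signLang]
  · rintro ⟨m, B, hB⟩
    exact B.lang_ne_signLang m hB
  · rintro ⟨m, A, hA⟩
    obtain ⟨B, hB⟩ := A.exists_altAutomaton
    exact B.lang_ne_signLang m ((hB m).trans hA)
  · exact fun m => ⟨_, MeanPayoff.guessAutomaton_lang m⟩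
  · intro m
    obtain ⟨B, hB⟩ := MeanPayoff.guessAutomaton.exists_altAutomaton
    exact ⟨B, (hB m).trans (MeanPayoff.guessAutomaton_lang m)⟩
  · rintro ⟨E, hE⟩
    exact E.lang_ne_finitelyManyA hE
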